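/- **Conventions.** Functions are complex valued, $L_2=L_2(\mathbb R)$, $\ell_2=\ell_2(\mathbb Z)$, $\widehat f$ is the unitary Fourier transform on $L_2$ that extends $\widehat f(\xi)=\frac1{\sqrt{2\pi}}\int_{\mathbb R}f(x)e^{-i\xi x}\,dx$, $\mathbb T=[-\pi,\pi)$, and $PW_\pi=\{f\in L_2:\widehat f=0\text{ a.e. outside }[-\pi,\pi]\}$. The value of an element of $L_2$ at a point means the value of its continuous representative. A sequence $\mathcal X=(x_j)_{j\in\mathbb Z}\subset\mathbb R$ is a complete interpolating sequence (CIS) for $PW_\pi$ if for every $(c_j)\in\ell_2$ there is a unique $f\in PW_\pi$ with $f(x_j)=c_j$ for all $j\in\mathbb Z$. For $\psi\in L_2$ let $V(\psi,\mathcal X)$ be the closed linear span in $L_2$ of $\{\psi(\cdot-x_j):j\in\mathbb Z\}$. For $\psi\in L_2$ consider * (A1) $\psi$ is (almost everywhere equal to) a positive definite function, that is, one for which all matrices $(\psi(t_i-t_j))_{i,j=1}^n$ with $t_1,\dots,t_n\in\mathbb R$ are positive semidefinite Hermitian; * (A2) $\sum_{k\in\mathbb Z}\|\widehat\psi(\cdot+2\pi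 k)\|_{L_\infty(\mathbb T)}<\infty$, $\ \delta_\psi:=\operatorname{ess\,inf}_{\xi\in\mathbb T}|\widehat\psi(\xi)|>0$, and $\ C_\psi:=\delta_\psi^{-1}\sum_{k\ne0}\|\widehat\psi(\cdot+2\pi k)\|_{L_\infty(\mathbb T)}<\infty$. If $\mathcal X$ is a CIS, every $h\in L_2(\mathbb T)$ has a unique expansion $h=\sum_j c_je^{-ix_j\cdot}$ in $L_2(\mathbb T)$ with $(c_j)\in\ell_2$; for $k\in\mathbb Z$ put $A_{\mathcal X}^kh:=\sum_jc_je^{-ix_j(\cdot+2\pi k)}\in L_2(\mathbb T)$. For $\phi$ satisfying (A1)–(A2), $k\in\mathbb Z$ and $g\in L_2(\mathbb T)$ put $$M_\phi g:=\frac{\delta_\phi}{\widehat\phi}\,g,\qquad T_{\phi,k}g:=\delta_\phi^{-1}\,\widehat\phi(\cdot+2\pi k)\,g .$$ **Theorem.** Let $\mathcal X$ and $\mathcal Y=(y_j)_{j\in\mathbb Z}$ be CISs for $PW_\pi$, let $\psi\in L_2$ satisfy (A1) and (A2), and let $(\phi_\alpha)_{\alpha\in A}\subset L_2$ be a family indexed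 by a nonempty directed set $A$ (for instance an unbounded set of positive real numbers), limits as $\alpha\to\infty$ being taken along $A$, such that * (B1) every $\phi_\alpha$ satisfies (A1) and (A2); * (B2) $\sup_{\alpha\in A}C_{\phi_\alpha}<\infty$; * (B3) $\lim_{\alpha\to\infty}\sum_{k\ne0}\|T_{\psi,k}A_{\mathcal X}^k(M_\psi-M_{\phi_\alpha})g\|_{L_2(\mathbb T)}=0$ for every $g\in L_2(\mathbb T)$; * (B4) $\lim_{\alpha\to\infty}\sum_{k\ne0}\|(T_{\phi_\alpha,k}A_{\mathcal Y}^k-T_{\psi,k}A_{\mathcal X}^k)M_{\phi_\alpha}g\|_{L_2(\mathbb T)}=0$ for every $g\in L_2(\mathbb T)$. Then for every $f\in V(\psi,\mathcal X)$ and every $\alpha\in A$ there is a unique $I_{\phi_\alpha}^{\mathcal Y}f\in V(\phi_\alpha,\mathcal Y)$ with $I_{\phi_\alpha}^{\mathcal Y}f(y_k)=f(y_k)$ for all $k\in\mathbb Z$ (in particular, $f$ and $I_{\phi_\alpha}^{\mathcal Y}f$ have continuous representatives), and $$\lim_{\alpha\to\infty}\|f-I_{\phi_\alpha}^{\mathcal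 Y}f\|_{L_2(\mathbb R)}=0 .$$ -/

import Mathlib

open MeasureTheory Filter Topology FourierTransform
open scoped ENNReal ComplexOrder

namespace QuasiShift

noncomputable section

/-- `L₂(ℝ)`, complex valued, as a space of a.e. classes. -/
abbrev L2R : Type := Lp ℂ 2 (volume : Measure ℝ)

/-- The torus, identified with the interval `[-π, π)`. -/
def torus : Set ℝ := Set.Ico (-Real.pi) Real.pi

/-- Lebesgue measure on the torus. -/
abbrev torusMeasure : Measure ℝ := volume.restrict torus

/-- `L₂(𝕋)`, complex valued, as a space of a.e. classes. -/
abbrev L2T : Type := Lp ℂ 2 torusMeasure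

instance : IsFiniteMeasure torusMeasure :=
  ⟨by simp [torus, Real.volume_Ico]⟩

/-- The unitary Fourier transform on `L₂(ℝ)`, the extension of
`f ↦ (2π)^(-1/2) ∫ f(x) exp(-iξx) dx`. Mathlib's `𝓕` on `L₂` extends `f ↦ ∫ f(x) exp(-2πiξx) dx`,
hence the rescaling. The value is a function determined up to a null set. -/
def fourierHat (f : L2R) : ℝ → ℂ := fun ξ =>
  ((Real.sqrt (2 * Real.pi) : ℝ) : ℂ)⁻¹ * (𝓕 f : L2R) (ξ / (2 * Real.pi))

/-- `F` is the continuous representative of the class `f`. Point values of elements of `L₂(ℝ)` are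
always those of the continuous representative, which is unique when it exists. -/
def IsContRep (f : L2R) (F : ℝ → ℂ) : Prop :=
  Continuous F ∧ f =ᵐ[volume] F

/-- Membership in the Paley-Wiener space `PW_π`. -/
def MemPW (f : L2R) : Prop :=
  ∀ᵐ ξ ∂(volume : Measure ℝ), ξ ∉ Set.Icc (-Real.pi) Real.pi → fourierHat f ξ = 0

/-- `X` is a complete interpolating sequence for `PW_π`: for all square-summable data there is
exactly one function in `PW_π` that takes these data as its values on `X`. -/
def IsCIS (X : ℤ → ℝ) : Prop :=
  ∀ c : ℤ → ℂ, Memℓp c 2 →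
    ∃! f : L2R, MemPW f ∧ ∃ F : ℝ → ℂ, IsContRep f F ∧ ∀ j, F (X j) = c j

/-- A positive definite function on `ℝ`: all matrices `(g (x i - x j))` are Hermitian and have
nonnegative quadratic form. -/
def IsPosDefFun (g : ℝ → ℂ) : Prop :=
  ∀ (n : ℕ) (x : Fin n → ℝ), (Matrix.of fun i j => g (x i - x j)).PosSemidef

/-- The norm of `g` in `L_∞(𝕋 + 2πk)`. -/
def supNormAt (g : ℝ → ℂ) (k : ℤ) : ℝ≥0∞ :=
  eLpNorm (fun ξ => g (ξ + 2 * Real.pi * k)) ∞ torusMeasure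

/-- Membership in the Wiener amalgam space `W(L_∞, ℓ₁)`. -/
def MemWiener (g : ℝ → ℂ) : Prop :=
  AEStronglyMeasurable g volume ∧ (∑' k : ℤ, supNormAt g k) < ∞

/-- `δ_ψ`, the (essential) infimum over `𝕋` of the modulus of the Fourier transform of `ψ`. -/
def delta (ψ : L2R) : ℝ≥0∞ :=
  essInf (fun ξ => ‖fourierHat ψ ξ‖ₑ) torusMeasure

/-- `C_ψ`, the sum over `j ≠ 0` of the norms of the Fourier transform of `ψ` in
`L_∞(𝕋 + 2πj)`, divided by `δ_ψ`. -/
def ratioConst (ψ : L2R) : ℝ≥0∞ :=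
  (∑' k : {k : ℤ // k ≠ 0}, supNormAt (fourierHat ψ) k) / delta ψ

/-- (A1): the class `ψ` in `L₂(ℝ)` is (that of) a positive definite function. -/
def CondA1 (ψ : L2R) : Prop :=
  ∃ g : ℝ → ℂ, ψ =ᵐ[volume] g ∧ IsPosDefFun g

/-- (A2): the Fourier transform of `ψ` lies in `W(L_∞, ℓ₁)` and the constant `C_ψ` is meaningful
(that is, `δ_ψ > 0`) and finite. -/
def CondA2 (ψ : L2R) : Prop :=
  MemWiener (fourierHat ψ) ∧ 0 < delta ψ ∧ ratioConst ψ < ∞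

/-- The quasi shift-invariant space `V(ψ, X)`: the closed linear span in `L₂(ℝ)` of the
translates `ψ(· - X j)`. -/
def quasiShiftSpace (ψ : L2R) (X : ℤ → ℝ) : Submodule ℂ L2R :=
  (Submodule.span ℂ {u : L2R | ∃ j : ℤ, u =ᵐ[volume] fun x => ψ (x - X j)}).topologicalClosure

/-- `u` interpolates `f` on `Y`: `u(Y k) = f(Y k)` for all `k`. -/
def Interpolates (Y : ℤ → ℝ) (f u : L2R) : Prop :=
  ∃ F U : ℝ → ℂ, IsContRep f F ∧ IsContRep u U ∧ ∀ k, U (Y k) = F (Y k)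

theorem memLp_expFun (x : ℝ) (k : ℤ) :
    MemLp (fun t : ℝ => Complex.exp (-(Complex.I * x * (t + 2 * Real.pi * k)))) 2
      torusMeasure := by
  refine MemLp.of_bound (C := 1) (Continuous.aestronglyMeasurable (by fun_prop)) ?_
  refine ae_of_all _ fun t => le_of_eq ?_
  rw [Complex.norm_exp]
  simp

/-- The element `t ↦ exp(-i x (t + 2πk))` of `L₂(𝕋)`. -/
def expT (x : ℝ) (k : ℤ) : L2T := (memLp_expFun x k).toLp _

open Classical in
/-- The coefficients `(c_j)` in `ℓ₂` of the expansion `h = ∑ c_j exp(-i x_j ·)` in `L₂(𝕋)`; they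
exist and are unique for every `h` when `X` is a complete interpolating sequence. -/
def expCoeff (X : ℤ → ℝ) (h : L2T) : ℤ → ℂ :=
  if H : ∃ c : ℤ → ℂ, Memℓp c 2 ∧ HasSum (fun j => c j • expT (X j) 0) h then H.choose else 0

/-- The prolongation operator `A_X^k`: if `h = ∑ c_j exp(-i x_j ·)` in `L₂(𝕋)`, then
`A_X^k h (t) = ∑ c_j exp(-i x_j (t + 2πk))` for `t` in `𝕋`. -/
def prolong (X : ℤ → ℝ) (k : ℤ) (h : L2T) : L2T :=
  ∑' j, expCoeff X h j • expT (X j) k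

open Classical in
/-- Multiplication by the function `m` on `L₂(𝕋)` (used below for bounded `m`). -/
def mulT (m : ℝ → ℂ) (g : L2T) : L2T :=
  if H : MemLp (fun ξ => m ξ * g ξ) 2 torusMeasure then H.toLp _ else 0

/-- `M_φ`: multiplication by `δ_φ` over the Fourier transform of `φ`. -/
def opM (φ : L2R) (g : L2T) : L2T :=
  mulT (fun ξ => ((delta φ).toReal : ℂ) / fourierHat φ ξ) g

/-- `T_{φ,k}`: multiplication by `δ_φ⁻¹` times the Fourier transform of `φ` at `· + 2πk`. -/
def opT (φ : L2R) (k : ℤ) (g : L2T) : L2T :=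
  mulT (fun ξ => ((delta φ).toReal : ℂ)⁻¹ * fourierHat φ (ξ + 2 * Real.pi * k)) g

/-- (B1): every member of the family satisfies (A1) and (A2). -/
def CondB1 {A : Type*} (φ : A → L2R) : Prop :=
  ∀ α, CondA1 (φ α) ∧ CondA2 (φ α)

/-- (B2): the constants of the family in (A2) are uniformly bounded. -/
def CondB2 {A : Type*} (φ : A → L2R) : Prop :=
  (⨆ α, ratioConst (φ α)) < ∞

/-- (B3): for every `g` in `L₂(𝕋)`, the sum over `k ≠ 0` of
`‖T_{ψ,k} A_X^k (M_ψ - M_{φ_α}) g‖` tends to `0`. -/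
def CondB3 {A : Type*} [Preorder A] (ψ : L2R) (X : ℤ → ℝ) (φ : A → L2R) : Prop :=
  ∀ g : L2T, Tendsto
    (fun α => ∑' k : {k : ℤ // k ≠ 0},
      ‖opT ψ k (prolong X k (opM ψ g - opM (φ α) g))‖ₑ)
    atTop (𝓝 0)

/-- (B4): for every `g` in `L₂(𝕋)`, the sum over `k ≠ 0` of
`‖(T_{φ_α,k} A_Y^k - T_{ψ,k} A_X^k) M_{φ_α} g‖` tends to `0`. -/
def CondB4 {A : Type*} [Preorder A] (ψ : L2R) (X Y : ℤ → ℝ) (φ : A → L2R) : Prop :=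
  ∀ g : L2T, Tendsto
    (fun α => ∑' k : {k : ℤ // k ≠ 0},
      ‖opT (φ α) k (prolong Y k (opM (φ α) g)) - opT ψ k (prolong X k (opM (φ α) g))‖ₑ)
    atTop (𝓝 0)

end

end QuasiShift

/-!
Everything happens on the Fourier side. For `f ∈ L₂(ℝ)` let `slice k f ∈ L₂(𝕋)` be the restriction
of the transform of `f` to the tile `𝕋 + 2πk`, moved to `𝕋`; then `‖f‖² = ∑ ‖slice k f‖²`.

*The sequences.* For a complete interpolating sequence `X` the exponentials `exp(-i x_j ·)` form a
Riesz basis of `L₂(𝕋)`. The moment problem has a bounded solution operator by the closed graph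
theorem, so `X` is separated; separation gives the upper Riesz bound (`exists_bessel_of_separated`)
and duality the invertibility of the synthesis operator (`exists_rieszBasis`). Since
`exp(-i x_j (t + 2πk))` differs from `exp(-i x_j t)` by a unimodular constant, the prolongation
operators `A_X^k` are bounded by a number `κ` that does not depend on `k`
(`IsCIS.nonempty_prolongOps`).

*The generators.* Condition (A1) makes the transform of `φ` nonnegative (`fourierHat_nonneg`), so
that `T_{φ,k} ≥ 0` for all `k` and `T_{φ,0} = M_φ⁻¹ ≥ 1`. A function `f` lies in `V(φ, Y)` only if
`slice k f = T_{φ,k} A_Y^k M_φ (slice 0 f)` for all `k`, and every element of `L₂(𝕋)` is `slice 0 f`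
for some such `f` (`slice_eq_of_mem`, `exists_mem_slice_zero_eq`).

*The interpolation problem.* The samples on `Y` of a function with summable slices are the moments
of `R f = ∑ (A_Y^k)* (slice k f)` (`inner_sampling`), and for `u ∈ V(φ, Y)` this is
`R u = P M_φ (slice 0 u)` with `P = ∑ (A_Y^k)* T_{φ,k} A_Y^k ≥ 1`. Hence `P` is invertible, and
interpolation of `f` on `Y`, which means `R u = R f`, has exactly one solution in `V(φ, Y)`.

*Convergence.* Put `g = slice 0 f`, `d = slice 0 (f - u)` and
`D k = slice k f - T_{φ,k} A_Y^k M_φ g`, so that `D 0 = 0` and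
`P M_φ d = -∑_{k ≠ 0} (A_Y^k)* (D k)`. The inverse of `P M_φ` is bounded by `1 + κ² C_φ`
(`norm_le_of_gram_M`), which is uniform along the family by (B2), although `M_φ⁻¹` need not be.
Therefore `‖f - u‖` is at most a constant times `∑_{k ≠ 0} ‖D k‖`
(`norm_sub_le_of_interpolates`). For `f ∈ V(ψ, X)` one has
`D k = T_{ψ,k} A_X^k (M_ψ - M_φ) g - (T_{φ,k} A_Y^k - T_{ψ,k} A_X^k) M_φ g`, and (B3) and (B4) say
that the sums of the norms of the two parts tend to zero.
-/

open MeasureTheory Filter Topology FourierTransform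
open scoped ENNReal ComplexOrder

namespace QuasiShift

noncomputable section

/-! ### Riesz bases and coercive operators in Hilbert space -/

/-- The Hilbert space of square-summable families of complex numbers indexed by `ℤ`. -/
abbrev Ell2 : Type := lp (fun _ : ℤ => ℂ) 2

/-- The unit vector of `Ell2` at the index `j`. -/
abbrev unitVec (j : ℤ) : Ell2 := lp.single 2 j (1 : ℂ)

theorem hasSum_smul_unitVec (c : Ell2) : HasSum (fun j => c j • unitVec j) c := by
  convert! lp.hasSum_single (by norm_num) c using 2 with j
  rw [← lp.single_smul]
  simp

theorem hasSum_norm_sq (c : Ell2) : HasSum (fun j => ‖c j‖ ^ 2) (‖c‖ ^ 2) := by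
  simpa using lp.hasSum_norm (p := 2) (by norm_num) c

theorem inner_unitVec (j : ℤ) (c : Ell2) : inner ℂ (unitVec j) c = c j := by
  rw [lp.inner_single_left]; simp

section Hilbert

variable {E : Type*} [NormedAddCommGroup E] [InnerProductSpace ℂ E] [CompleteSpace E]

/-- A system of vectors whose finite combinations satisfy an upper `ℓ₂` estimate has a bounded
synthesis operator. -/
theorem exists_synthesis (v : ℤ → E) (K : ℝ)
    (hK : ∀ (s : Finset ℤ) (c : ℤ → ℂ), ‖∑ j ∈ s, c j • v j‖ ^ 2 ≤ K * ∑ j ∈ s, ‖c j‖ ^ 2) :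
    ∃ S : Ell2 →L[ℂ] E, (∀ j, S (unitVec j) = v j) ∧ ‖S‖ ≤ √K := by
  have hK0 : 0 ≤ K := by
    have := hK {0} (fun _ => 1)
    simp only [Finset.sum_singleton, norm_one, one_pow, mul_one] at this
    exact (sq_nonneg _).trans this
  have hsum : ∀ c : Ell2, Summable fun j => c j • v j := by
    intro c
    rw [summable_iff_vanishing_norm]
    intro ε hε
    obtain ⟨s, hs⟩ := summable_iff_vanishing_norm.1 (hasSum_norm_sq c).summable
      (ε ^ 2 / (K + 1)) (by positivity)
    refine ⟨s, fun t ht => ?_⟩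
    have h1 := hs t ht
    rw [Real.norm_of_nonneg (by positivity), lt_div_iff₀ (by positivity)] at h1
    have h2 := hK t c
    have h3 : 0 ≤ ∑ j ∈ t, ‖c j‖ ^ 2 := by positivity
    exact lt_of_pow_lt_pow_left₀ 2 hε.le (by nlinarith)
  have hbound : ∀ c : Ell2, ‖∑' j, c j • v j‖ ≤ √K * ‖c‖ := by
    intro c
    refine le_of_tendsto (hsum c).hasSum.norm (Eventually.of_forall fun s => ?_)
    refine (abs_le_of_sq_le_sq' ?_ (by positivity)).2
    rw [mul_pow, Real.sq_sqrt hK0]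
    refine (hK s c).trans (mul_le_mul_of_nonneg_left ?_ hK0)
    exact sum_le_hasSum s (fun _ _ => by positivity) (hasSum_norm_sq c)
  let L : Ell2 →ₗ[ℂ] E :=
    { toFun := fun c => ∑' j, c j • v j
      map_add' := fun a b => by
        rw [← (hsum a).tsum_add (hsum b)]
        simp [add_smul]
      map_smul' := fun a b => by
        rw [RingHom.id_apply, ← (hsum b).tsum_const_smul]
        simp [smul_smul] }
  refine ⟨L.mkContinuous _ hbound, fun j => ?_,
    LinearMap.mkContinuous_norm_le _ (Real.sqrt_nonneg _) _⟩
  change ∑' i, unitVec j i • v i = v j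
  rw [tsum_eq_single j fun i hi => by simp [unitVec, Pi.single_eq_of_ne hi]]
  simp

/-- A bounded operator on a Hilbert space with `‖x‖² ≤ Re ⟪P x, x⟫` is surjective. -/
theorem surjective_of_coercive (P : E →L[ℂ] E)
    (hP : ∀ x, ‖x‖ ^ 2 ≤ RCLike.re (inner ℂ (P x) x)) : Function.Surjective P := by
  have hb : ∀ x, ‖x‖ ≤ ‖P x‖ := by
    intro x
    by_contra! hlt
    have h1 := hP x
    have h2 : RCLike.re (inner ℂ (P x) x) ≤ ‖P x‖ * ‖x‖ := re_inner_le_norm _ _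
    have h3 : 0 < ‖x‖ := (norm_nonneg _).trans_lt hlt
    nlinarith
  have hanti : AntilipschitzWith 1 P :=
    P.antilipschitz_of_bound (by simpa using hb)
  have hcl : IsClosed (LinearMap.range P.toLinearMap : Set E) := by
    rw [LinearMap.coe_range]
    exact hanti.isClosed_range P.uniformContinuous
  have : CompleteSpace (LinearMap.range P.toLinearMap) := hcl.completeSpace_coe
  have htop : LinearMap.range P.toLinearMap = ⊤ := by
    rw [← Submodule.orthogonal_eq_bot_iff, Submodule.eq_bot_iff]
    intro z hz
    have h0 : inner ℂ (P z) z = 0 := hz (P z) ⟨z, rfl⟩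
    have := hP z
    rw [h0] at this
    simpa using this
  exact LinearMap.range_eq_top.1 htop

/-- If the moment problem `⟪e j, h⟫ = c j` has exactly one solution for all square-summable data,
then its solution operator is bounded. -/
theorem exists_momentSolution (e : ℤ → E)
    (he : ∀ c : Ell2, ∃! h : E, ∀ j, inner ℂ (e j) h = c j) :
    ∃ R : Ell2 →L[ℂ] E, ∀ c j, inner ℂ (e j) (R c) = c j := by
  choose R hR hu using he
  let L : Ell2 →ₗ[ℂ] E :=
    { toFun := R
      map_add' := fun a b => (hu _ _ fun j => by simp [hR]).symm
      map_smul' := fun a b => (hu _ _ fun j => by simp [hR]).symm }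
  refine ⟨⟨L, L.continuous_of_seq_closed_graph ?_⟩, hR⟩
  intro u x y hx hy
  refine (hu x y fun j => ?_)
  have h1 : Tendsto (fun n => inner ℂ (e j) (R (u n))) atTop (𝓝 (inner ℂ (e j) y)) :=
    tendsto_const_nhds.inner hy
  have h2 : Tendsto (fun n => inner ℂ (unitVec j) (u n)) atTop (𝓝 (inner ℂ (unitVec j) x)) :=
    tendsto_const_nhds.inner hx
  simp only [inner_unitVec] at h2
  simp only [hR] at h1
  exact tendsto_nhds_unique h1 h2

/-- If moreover the system has a bounded synthesis operator, then this operator is invertible,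
that is, the system is a Riesz basis. -/
theorem exists_rieszBasis (e : ℤ → E)
    (he : ∀ c : Ell2, ∃! h : E, ∀ j, inner ℂ (e j) h = c j)
    (S : Ell2 →L[ℂ] E) (hS : ∀ j, S (unitVec j) = e j) :
    ∃ R : E →L[ℂ] Ell2, (∀ c, R (S c) = c) ∧ ∀ h, S (R h) = h := by
  obtain ⟨R, hR⟩ := exists_momentSolution e he
  -- `S*` takes moments, so that `S*` and `R` are inverse to each other; then so are `S` and `R*`
  have hadj : ∀ h j, S.adjoint h j = inner ℂ (e j) h := fun h j => by
    rw [← inner_unitVec, ContinuousLinearMap.adjoint_inner_right, hS]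
  have h1 : S.adjoint ∘L R = ContinuousLinearMap.id ℂ _ := by
    ext c j
    simp [hadj, hR]
  have h2 : R ∘L S.adjoint = ContinuousLinearMap.id ℂ _ := by
    ext h
    refine (he (S.adjoint h)).unique (fun j => ?_) (fun j => (hadj h j).symm)
    simp [hR]
  refine ⟨R.adjoint, fun c => ext_inner_right ℂ fun d => ?_, fun h => ext_inner_right ℂ fun d => ?_⟩
  · have := congrArg (fun T => T d) h1
    simp only [ContinuousLinearMap.comp_apply, ContinuousLinearMap.id_apply] at this
    rw [ContinuousLinearMap.adjoint_inner_left, ← ContinuousLinearMap.adjoint_inner_right, this]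
  · have := congrArg (fun T => T d) h2
    simp only [ContinuousLinearMap.comp_apply, ContinuousLinearMap.id_apply] at this
    rw [← ContinuousLinearMap.adjoint_inner_right, ContinuousLinearMap.adjoint_inner_left, this]

end Hilbert

/-! ### Multiplication operators -/

section Mul

variable {α : Type*} [MeasurableSpace α] {μ : Measure α}

theorem memLp_mul_of_bound {m : α → ℂ} {C : ℝ} (hm : AEStronglyMeasurable m μ)
    (hC : ∀ᵐ x ∂μ, ‖m x‖ ≤ C) (g : Lp ℂ 2 μ) : MemLp (fun x => m x * g x) 2 μ :=
  (Lp.memLp g).of_le_mul (hm.mul (Lp.aestronglyMeasurable g)) (c := C) <| by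
    filter_upwards [hC] with x hx
    rw [norm_mul]
    gcongr

/-- Multiplication by a function `m` with `|m| ≤ C` a.e., as a bounded operator on `L₂`. -/
def mulCLM (m : α → ℂ) (C : ℝ) (hm : AEStronglyMeasurable m μ)
    (hC : ∀ᵐ x ∂μ, ‖m x‖ ≤ C) : Lp ℂ 2 μ →L[ℂ] Lp ℂ 2 μ :=
  LinearMap.mkContinuous
    { toFun := fun g => (memLp_mul_of_bound hm hC g).toLp _
      map_add' := fun f g => by
        rw [← MemLp.toLp_add]
        refine MemLp.toLp_congr _ _ ?_
        filter_upwards [Lp.coeFn_add f g] with x hx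
        rw [hx]
        exact mul_add _ _ _
      map_smul' := fun c g => by
        rw [RingHom.id_apply, ← MemLp.toLp_const_smul]
        refine MemLp.toLp_congr _ _ ?_
        filter_upwards [Lp.coeFn_smul c g] with x hx
        rw [hx]
        exact mul_left_comm _ _ _ } C <| fun g => by
    refine Lp.norm_le_mul_norm_of_ae_le_mul ?_
    filter_upwards [hC, (memLp_mul_of_bound hm hC g).coeFn_toLp] with x hx h2
    change ‖((memLp_mul_of_bound hm hC g).toLp _) x‖ ≤ _
    rw [h2, norm_mul]
    gcongr

theorem coeFn_mulCLM {m : α → ℂ} {C : ℝ} (hm : AEStronglyMeasurable m μ)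
    (hC : ∀ᵐ x ∂μ, ‖m x‖ ≤ C) (g : Lp ℂ 2 μ) :
    mulCLM m C hm hC g =ᵐ[μ] fun x => m x * g x :=
  (memLp_mul_of_bound hm hC g).coeFn_toLp

theorem norm_mulCLM_le {m : α → ℂ} {C : ℝ} (hm : AEStronglyMeasurable m μ)
    (hC : ∀ᵐ x ∂μ, ‖m x‖ ≤ C) (hC0 : 0 ≤ C) : ‖mulCLM m C hm hC‖ ≤ C :=
  LinearMap.mkContinuous_norm_le _ hC0 _

end Mul

theorem mulT_eq_mulCLM {m : ℝ → ℂ} {C : ℝ} (hm : AEStronglyMeasurable m torusMeasure)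
    (hC : ∀ᵐ x ∂torusMeasure, ‖m x‖ ≤ C) (g : L2T) : mulT m g = mulCLM m C hm hC g := by
  rw [mulT, dif_pos (memLp_mul_of_bound hm hC g)]
  rfl

/-! ### Tiling the line by translates of the torus -/

theorem measurableSet_torus : MeasurableSet torus := measurableSet_Ico

/-- The translate `𝕋 + 2πk`. -/
def tile (k : ℤ) : Set ℝ :=
  Set.Ico (-Real.pi + k • (2 * Real.pi)) (-Real.pi + (k + 1) • (2 * Real.pi))

theorem measurableSet_tile (k : ℤ) : MeasurableSet (tile k) := measurableSet_Ico

theorem iUnion_tile : ⋃ k, tile k = Set.univ := iUnion_Ico_add_zsmul Real.two_pi_pos _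

theorem pairwise_disjoint_tile : Pairwise (Function.onFun Disjoint tile) :=
  Set.pairwise_disjoint_Ico_add_zsmul _ _

theorem preimage_tile (k : ℤ) : (fun ξ : ℝ => ξ + 2 * Real.pi * k) ⁻¹' tile k = torus := by
  ext ξ
  simp only [tile, torus, Set.mem_preimage, Set.mem_Ico, zsmul_eq_mul]
  push_cast
  constructor <;> rintro ⟨h1, h2⟩ <;> constructor <;> linarith

/-- The translation by `2πk` carries the measure of the torus to that of the tile `𝕋 + 2πk`. -/
theorem measurePreserving_tile (k : ℤ) :
    MeasurePreserving (fun ξ : ℝ => ξ + 2 * Real.pi * k) torusMeasure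
      (volume.restrict (tile k)) := by
  have := (measurePreserving_add_right (volume : Measure ℝ) (2 * Real.pi * k)).restrict_preimage
    (measurableSet_tile k)
  rwa [preimage_tile] at this

theorem lintegral_eq_tsum_torus (F : ℝ → ℝ≥0∞) :
    ∫⁻ ξ, F ξ = ∑' k : ℤ, ∫⁻ ξ, F (ξ + 2 * Real.pi * k) ∂torusMeasure := by
  rw [← setLIntegral_univ, ← iUnion_tile,
    lintegral_iUnion measurableSet_tile pairwise_disjoint_tile]
  refine tsum_congr fun k => ?_
  exact ((measurePreserving_tile k).lintegral_comp_emb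
    (measurableEmbedding_addRight _) F).symm

theorem hasSum_integral_torus {F : ℝ → ℂ} (hF : Integrable F) :
    HasSum (fun k : ℤ => ∫ ξ, F (ξ + 2 * Real.pi * k) ∂torusMeasure) (∫ ξ, F ξ) := by
  have := hasSum_integral_iUnion (f := F) measurableSet_tile pairwise_disjoint_tile
    (by rw [iUnion_tile]; exact hF.integrableOn)
  rw [iUnion_tile, setIntegral_univ] at this
  refine this.congr_fun fun k => ?_
  exact ((measurePreserving_tile k).integral_comp (measurableEmbedding_addRight _) F)

theorem ae_iff_forall_torus {p : ℝ → Prop} :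
    (∀ᵐ ξ, p ξ) ↔ ∀ k : ℤ, ∀ᵐ ξ ∂torusMeasure, p (ξ + 2 * Real.pi * k) := by
  rw [← Measure.restrict_univ (μ := (volume : Measure ℝ)), ← iUnion_tile, ae_restrict_iUnion_iff]
  refine forall_congr' fun k => ?_
  rw [← (measurePreserving_tile k).map_eq, (measurableEmbedding_addRight _).ae_map_iff]

/-! ### The Fourier transform on `L₂(ℝ)` -/

/-- The translation `f ↦ f(· - a)` on `L₂(ℝ)`. -/
def translate (a : ℝ) : L2R →ₗᵢ[ℂ] L2R :=
  Lp.compMeasurePreservingₗᵢ ℂ (fun x => x - a) (measurePreserving_sub_right volume a)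

theorem coeFn_translate (a : ℝ) (f : L2R) : translate a f =ᵐ[volume] fun x => f (x - a) :=
  Lp.coeFn_compMeasurePreserving f (measurePreserving_sub_right volume a)

theorem fourier_translate (a : ℝ) (f : L2R) :
    (𝓕 (translate a f) : L2R) =ᵐ[volume]
      fun η => Complex.exp (-(2 * Real.pi * a * η * Complex.I)) * (𝓕 f : L2R) η := by
  have hm : AEStronglyMeasurable (fun η : ℝ => Complex.exp (-(2 * Real.pi * a * η * Complex.I)))
      volume := Continuous.aestronglyMeasurable (by fun_prop)
  have hC : ∀ᵐ η : ℝ, ‖Complex.exp (-(2 * Real.pi * a * η * Complex.I))‖ ≤ 1 :=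
    ae_of_all _ fun η => by rw [Complex.norm_exp]; simp
  -- both sides are continuous in `f`, and for Schwartz functions the transform is an integral
  have key : (𝓕 (translate a f) : L2R) = mulCLM _ 1 hm hC (𝓕 f) := by
    refine DenseRange.induction_on
      (p := fun f : L2R => (𝓕 (translate a f) : L2R) = mulCLM _ 1 hm hC (𝓕 f))
      (SchwartzMap.denseRange_toLpCLM (p := 2) (F := ℂ) (E := ℝ) ENNReal.ofNat_ne_top) f ?_ ?_
    · refine isClosed_eq ?_ ?_
      · exact (Lp.fourierTransformₗᵢ ℝ ℂ).continuous.comp (translate a).continuous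
      · exact (mulCLM _ 1 hm hC).continuous.comp (Lp.fourierTransformₗᵢ ℝ ℂ).continuous
    · intro g
      have h1 : translate a (g.toLp 2) = (g.compSubConstCLM ℂ a).toLp 2 := by
        refine Lp.ext ?_
        filter_upwards [coeFn_translate a (g.toLp 2), (g.compSubConstCLM ℂ a).coeFn_toLp 2 volume,
          (measurePreserving_sub_right volume a).quasiMeasurePreserving.ae
            (g.coeFn_toLp 2 volume)] with x h1 h2 h3
        rw [h1, h2, h3, SchwartzMap.compSubConstCLM_apply]
      rw [SchwartzMap.toLpCLM_apply, h1, SchwartzMap.toLp_fourier_eq, SchwartzMap.toLp_fourier_eq]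
      refine Lp.ext ?_
      filter_upwards [(𝓕 (g.compSubConstCLM ℂ a)).coeFn_toLp 2 volume,
        coeFn_mulCLM hm hC ((𝓕 g).toLp 2), (𝓕 g).coeFn_toLp 2 volume] with η h1 h2 h3
      rw [h1, h2, h3, SchwartzMap.fourier_coe, SchwartzMap.fourier_coe]
      have h4 : ⇑(g.compSubConstCLM ℂ a) = ⇑g ∘ fun v => v + -a := by
        ext x
        simp [SchwartzMap.compSubConstCLM_apply, sub_eq_add_neg]
      have h5 := congrFun (VectorFourier.fourierIntegral_comp_add_right Real.fourierChar volume
        (innerₗ ℝ) g (-a)) η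
      rw [h4]
      refine h5.trans ?_
      rw [Circle.smul_def, Real.fourierChar_apply, smul_eq_mul]
      congr 2
      simp
      ring
  rw [key]
  exact coeFn_mulCLM hm hC _

open scoped ContDiff in
/-- Fourier inversion for `f ∈ L₂` with integrable transform: the two sides have the same pairing
with every test function. -/
theorem ae_eq_fourierInv_of_integrable (f : L2R) (hf : Integrable (𝓕 f : L2R)) :
    f =ᵐ[volume] 𝓕⁻ (⇑(𝓕 f : L2R)) := by
  have hL : Continuous fun p : ℝ × ℝ => (-innerₗ ℝ) p.1 p.2 := by
    exact (continuous_inner (𝕜 := ℝ) (E := ℝ)).neg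
  have hcont : Continuous (𝓕⁻ (⇑(𝓕 f : L2R))) :=
    VectorFourier.fourierIntegral_continuous Real.continuous_fourierChar hL hf
  refine ae_eq_of_integral_contDiff_smul_eq ?_ ?_ fun g hg hgc => ?_
  · exact (Lp.memLp f).locallyIntegrable (by norm_num)
  · exact hcont.locallyIntegrable
  · have hg₁ : HasCompactSupport (Complex.ofRealCLM ∘ g) := hgc.comp_left rfl
    have hg₂ : ContDiff ℝ ∞ (Complex.ofRealCLM ∘ g) := by fun_prop
    set G := hg₁.toSchwartzMap hg₂ with hG
    have hGa : ∀ x, G x = (g x : ℂ) := fun x => rfl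
    have h1 : ∀ u : ℝ → ℂ, ∫ x, g x • u x = ∫ x, G x • u x := fun u => by
      simp [hGa]
    have h2 : (f : TemperedDistribution ℝ ℂ) G =
        ((𝓕 f : L2R) : TemperedDistribution ℝ ℂ) (𝓕⁻ G) := by
      have := Lp.fourierInv_toTemperedDistribution_eq (𝓕 f : L2R)
      rw [FourierTransform.fourierInv_fourier_eq] at this
      rw [← this]
      rfl
    rw [Lp.toTemperedDistribution_apply, Lp.toTemperedDistribution_apply] at h2
    rw [h1, h1, h2, SchwartzMap.fourierInv_coe]
    have hflip : (-innerₗ ℝ).flip = -innerₗ ℝ := by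
      ext; simp
    have := VectorFourier.integral_fourierIntegral_smul_eq_flip (μ := volume) (ν := volume)
      Real.continuous_fourierChar hL G.integrable hf
    rw [hflip] at this
    exact this

/-! ### Slices of the Fourier transform over the tiles -/

theorem stronglyMeasurable_fourierHat (f : L2R) : StronglyMeasurable (fourierHat f) :=
  ((Lp.stronglyMeasurable (𝓕 f : L2R)).comp_measurable (measurable_id.div_const _)).const_mul _

theorem quasiMeasurePreserving_div_two_pi :
    Measure.QuasiMeasurePreserving (fun ξ : ℝ => ξ / (2 * Real.pi)) volume volume := by
  refine ⟨measurable_id.div_const _, ?_⟩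
  simp_rw [div_eq_mul_inv]
  rw [Real.map_volume_mul_right (by simp [Real.pi_ne_zero])]
  exact Measure.smul_absolutelyContinuous

theorem lintegral_comp_div_two_pi {F : ℝ → ℝ≥0∞} (hF : Measurable F) :
    ∫⁻ ξ, F (ξ / (2 * Real.pi)) = ENNReal.ofReal (2 * Real.pi) * ∫⁻ η, F η := by
  simp_rw [div_eq_mul_inv]
  rw [← lintegral_map (g := fun ξ : ℝ => ξ * (2 * Real.pi)⁻¹) hF (measurable_id.mul_const _),
    Real.map_volume_mul_right (by simp [Real.pi_ne_zero]), lintegral_smul_measure]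
  simp [abs_of_pos Real.pi_pos]

/-- Plancherel's theorem for the unitary Fourier transform. -/
theorem lintegral_fourierHat_sq (f : L2R) :
    ∫⁻ ξ, ‖fourierHat f ξ‖ₑ ^ 2 = ‖f‖ₑ ^ 2 := by
  have h1 : ∀ g : L2R, ∫⁻ x, ‖g x‖ₑ ^ 2 = ‖g‖ₑ ^ 2 := fun g => by
    rw [Lp.enorm_def]
    have := eLpNorm_nnreal_pow_eq_lintegral (f := g) (μ := volume) (p := 2) (by norm_num)
    simpa using this.symm
  have h2 : ‖(𝓕 f : L2R)‖ₑ = ‖f‖ₑ := by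
    rw [← ofReal_norm, ← ofReal_norm, Lp.norm_fourier_eq]
  simp only [fourierHat, enorm_mul, mul_pow]
  rw [lintegral_const_mul' _ _ (ENNReal.pow_ne_top enorm_ne_top),
    lintegral_comp_div_two_pi (F := fun η => ‖(𝓕 f : L2R) η‖ₑ ^ 2)
      ((Lp.stronglyMeasurable (𝓕 f : L2R)).enorm.pow_const 2), h1, h2, ← mul_assoc]
  have h3 : ‖((Real.sqrt (2 * Real.pi) : ℝ) : ℂ)⁻¹‖ₑ ^ 2 * ENNReal.ofReal (2 * Real.pi) = 1 := by
    rw [← ofReal_norm, norm_inv, Complex.norm_real, Real.norm_of_nonneg (by positivity),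
      ← ENNReal.ofReal_pow (by positivity), ← ENNReal.ofReal_mul (by positivity), inv_pow,
      Real.sq_sqrt (by positivity), inv_mul_cancel₀ (by positivity), ENNReal.ofReal_one]
  rw [h3, one_mul]

theorem fourierHat_add (f g : L2R) :
    fourierHat (f + g) =ᵐ[volume] fun ξ => fourierHat f ξ + fourierHat g ξ := by
  have h : (𝓕 (f + g) : L2R) = 𝓕 f + 𝓕 g := FourierTransform.fourier_add f g
  filter_upwards [quasiMeasurePreserving_div_two_pi.ae (Lp.coeFn_add (𝓕 f : L2R) (𝓕 g))]
    with ξ hξ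
  rw [fourierHat, h, hξ, Pi.add_apply, mul_add]
  rfl

theorem fourierHat_smul (c : ℂ) (f : L2R) :
    fourierHat (c • f) =ᵐ[volume] fun ξ => c * fourierHat f ξ := by
  have h : (𝓕 (c • f) : L2R) = c • 𝓕 f := FourierTransform.fourier_smul c f
  filter_upwards [quasiMeasurePreserving_div_two_pi.ae (Lp.coeFn_smul c (𝓕 f : L2R))] with ξ hξ
  rw [fourierHat, h, hξ, Pi.smul_apply, smul_eq_mul, mul_left_comm]
  rfl

theorem fourierHat_translate (x : ℝ) (f : L2R) :
    fourierHat (translate x f) =ᵐ[volume]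
      fun ξ => Complex.exp (-(Complex.I * x * ξ)) * fourierHat f ξ := by
  filter_upwards [quasiMeasurePreserving_div_two_pi.ae (fourier_translate x f)] with ξ hξ
  rw [fourierHat, hξ, mul_left_comm]
  congr 2
  have : (Real.pi : ℂ) ≠ 0 := by exact_mod_cast Real.pi_ne_zero
  push_cast
  field_simp

theorem lintegral_slice_sq (f : L2R) :
    ∑' k : ℤ, eLpNorm (fun ξ => fourierHat f (ξ + 2 * Real.pi * k)) 2 torusMeasure ^ 2
      = ‖f‖ₑ ^ 2 := by
  rw [← lintegral_fourierHat_sq, lintegral_eq_tsum_torus]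
  refine tsum_congr fun k => ?_
  have := eLpNorm_nnreal_pow_eq_lintegral (f := fun ξ => fourierHat f (ξ + 2 * Real.pi * k))
    (μ := torusMeasure) (p := 2) (by norm_num)
  simpa using this

theorem eLpNorm_slice_le (k : ℤ) (f : L2R) :
    eLpNorm (fun ξ => fourierHat f (ξ + 2 * Real.pi * k)) 2 torusMeasure ≤ ‖f‖ₑ := by
  have h := ENNReal.le_tsum (f := fun k : ℤ =>
    eLpNorm (fun ξ => fourierHat f (ξ + 2 * Real.pi * k)) 2 torusMeasure ^ 2) k
  rw [lintegral_slice_sq] at h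
  exact (ENNReal.pow_le_pow_left_iff two_ne_zero).1 h

theorem memLp_slice (k : ℤ) (f : L2R) :
    MemLp (fun ξ => fourierHat f (ξ + 2 * Real.pi * k)) 2 torusMeasure :=
  ⟨((stronglyMeasurable_fourierHat f).comp_measurable
    (measurable_id.add_const _)).aestronglyMeasurable,
    (eLpNorm_slice_le k f).trans_lt enorm_lt_top⟩

/-- The slice `ξ ↦ f̂(ξ + 2πk)` of the Fourier transform, as a bounded operator into `L₂(𝕋)`. -/
def slice (k : ℤ) : L2R →L[ℂ] L2T :=
  LinearMap.mkContinuous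
    { toFun := fun f => (memLp_slice k f).toLp _
      map_add' := fun f g => by
        rw [← MemLp.toLp_add]
        exact MemLp.toLp_congr _ _ (ae_iff_forall_torus.1 (fourierHat_add f g) k)
      map_smul' := fun c f => by
        rw [RingHom.id_apply, ← MemLp.toLp_const_smul]
        exact MemLp.toLp_congr _ _ (ae_iff_forall_torus.1 (fourierHat_smul c f) k) } 1 <|
    fun f => by
    rw [one_mul]
    change ‖(memLp_slice k f).toLp _‖ ≤ _
    rw [Lp.norm_toLp]
    exact ENNReal.toReal_le_of_le_ofReal (norm_nonneg _)
      ((eLpNorm_slice_le k f).trans_eq (ofReal_norm f).symm)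

theorem coeFn_slice (k : ℤ) (f : L2R) :
    slice k f =ᵐ[torusMeasure] fun ξ => fourierHat f (ξ + 2 * Real.pi * k) :=
  (memLp_slice k f).coeFn_toLp

theorem norm_slice_le (k : ℤ) (f : L2R) : ‖slice k f‖ ≤ ‖f‖ := by
  simpa using (slice k).le_of_opNorm_le (LinearMap.mkContinuous_norm_le _ zero_le_one _) f

theorem enorm_slice (k : ℤ) (f : L2R) :
    ‖slice k f‖ₑ = eLpNorm (fun ξ => fourierHat f (ξ + 2 * Real.pi * k)) 2 torusMeasure :=
  Lp.enorm_toLp (memLp_slice k f)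

theorem tsum_enorm_slice_sq (f : L2R) : ∑' k : ℤ, ‖slice k f‖ₑ ^ 2 = ‖f‖ₑ ^ 2 := by
  simp_rw [enorm_slice, lintegral_slice_sq]

theorem tsum_enorm_slice {f : L2R} (hf : Summable fun k => ‖slice k f‖) :
    ∑' k : ℤ, ‖slice k f‖ₑ = ENNReal.ofReal (∑' k, ‖slice k f‖) := by
  rw [ENNReal.ofReal_tsum_of_nonneg (fun _ => norm_nonneg _) hf]
  simp_rw [ofReal_norm]

theorem norm_le_tsum_slice {f : L2R} (hf : Summable fun k => ‖slice k f‖) :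
    ‖f‖ ≤ ∑' k : ℤ, ‖slice k f‖ := by
  have h : ‖f‖ₑ ≤ ∑' k : ℤ, ‖slice k f‖ₑ := by
    refine (ENNReal.pow_le_pow_left_iff two_ne_zero).1 ?_
    rw [← tsum_enorm_slice_sq, sq, ← ENNReal.tsum_mul_right]
    refine ENNReal.tsum_le_tsum fun k => ?_
    rw [sq]
    gcongr
    exact ENNReal.le_tsum k
  rw [tsum_enorm_slice hf, ← ofReal_norm] at h
  exact (ENNReal.ofReal_le_ofReal_iff (tsum_nonneg fun _ => norm_nonneg _)).1 h

theorem coeFn_expT (x : ℝ) (k : ℤ) :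
    expT x k =ᵐ[torusMeasure] fun t : ℝ => Complex.exp (-(Complex.I * x * (t + 2 * Real.pi * k))) :=
  (memLp_expFun x k).coeFn_toLp

theorem slice_translate (k : ℤ) (x : ℝ) (f : L2R) :
    slice k (translate x f) =ᵐ[torusMeasure]
      fun ξ => fourierHat f (ξ + 2 * Real.pi * k) * expT x k ξ := by
  filter_upwards [coeFn_slice k (translate x f), coeFn_expT x k,
    ae_iff_forall_torus.1 (fourierHat_translate x f) k] with ξ h1 h2 h3
  rw [h1, h2, h3, mul_comm]
  push_cast
  rfl

/-- The Paley-Wiener space consists of the functions whose slices vanish except for the one over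
`𝕋`. The definition of this space has the closed interval in place of `𝕋`; the point `π`, which
belongs to the tile with `k = 1`, has measure zero. -/
theorem memPW_iff (f : L2R) : MemPW f ↔ ∀ k : ℤ, k ≠ 0 → slice k f = 0 := by
  have h0 : ∀ k : ℤ, slice k f = 0 ↔
      ∀ᵐ ξ ∂torusMeasure, fourierHat f (ξ + 2 * Real.pi * k) = 0 := fun k => by
    rw [Lp.eq_zero_iff_ae_eq_zero]
    exact ⟨fun h => (coeFn_slice k f).symm.trans h, fun h => (coeFn_slice k f).trans h⟩
  simp_rw [h0, MemPW, ae_iff_forall_torus]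
  refine ⟨fun h k hk => ?_, fun h k => ?_⟩
  · filter_upwards [h k, ae_restrict_mem measurableSet_torus,
      ae_restrict_of_ae (Measure.ae_ne volume (-Real.pi))] with ξ h1 h2 h3
    refine h1 fun h4 => ?_
    obtain ⟨h5, h6⟩ := h2
    obtain ⟨h7, h8⟩ := h4
    have h9 := lt_of_le_of_ne h5 (Ne.symm h3)
    rcases lt_or_gt_of_ne hk with hk | hk
    · have : (k : ℝ) ≤ -1 := by exact_mod_cast Int.le_sub_one_of_lt hk
      nlinarith [Real.pi_pos]
    · have : (1 : ℝ) ≤ k := by exact_mod_cast hk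
      nlinarith [Real.pi_pos]
  · by_cases hk : k = 0
    · subst hk
      filter_upwards [ae_restrict_mem measurableSet_torus] with ξ hξ hn
      refine absurd ?_ hn
      simpa using Set.Ico_subset_Icc_self hξ
    · filter_upwards [h k hk] with ξ hξ _ using hξ

/-- Every element of `L₂(𝕋)` is the transform of a function in the Paley-Wiener space. -/
theorem exists_memPW_slice_zero (h : L2T) : ∃ f : L2R, MemPW f ∧ slice 0 f = h := by
  have hpi : (2 * Real.pi) ≠ 0 := by positivity
  have hs : ((√(2 * Real.pi) : ℝ) : ℂ) ≠ 0 := by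
    exact_mod_cast (Real.sqrt_pos.2 Real.two_pi_pos).ne'
  have h1 : MemLp (torus.indicator h) 2 volume :=
    (memLp_indicator_iff_restrict measurableSet_torus).2 (Lp.memLp h)
  have h2 : MemLp (fun η => ((√(2 * Real.pi) : ℝ) : ℂ) * torus.indicator h (η * (2 * Real.pi)))
      2 volume := by
    refine MemLp.const_mul ?_ _
    refine (memLp_map_measure_iff (f := fun η : ℝ => η * (2 * Real.pi)) (g := torus.indicator h)
      ?_ (measurable_id.mul_const _).aemeasurable).1 ?_
    · rw [Real.map_volume_mul_right hpi]
      exact h1.1.mono_ac Measure.smul_absolutelyContinuous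
    · rw [Real.map_volume_mul_right hpi]
      exact h1.smul_measure ENNReal.ofReal_ne_top
  -- the inverse transform of the rescaled extension of `h` by zero
  have h3 : fourierHat (𝓕⁻ (h2.toLp _)) =ᵐ[volume] torus.indicator h := by
    filter_upwards [quasiMeasurePreserving_div_two_pi.ae h2.coeFn_toLp] with ξ hξ
    rw [fourierHat, FourierTransform.fourier_fourierInv_eq, hξ, div_mul_cancel₀ _ hpi,
      inv_mul_cancel_left₀ hs]
  have h4 := ae_iff_forall_torus.1 h3
  refine ⟨𝓕⁻ (h2.toLp _), ?_, ?_⟩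
  · rw [MemPW]
    filter_upwards [h3] with ξ h5 h6
    rw [h5, Set.indicator_of_notMem (s := torus) fun h7 => h6 (Set.Ico_subset_Icc_self h7)]
  · refine Lp.ext ?_
    filter_upwards [coeFn_slice 0 (𝓕⁻ (h2.toLp _)), h4 0, ae_restrict_mem measurableSet_torus]
      with ξ h5 h6 h7
    rw [h5, h6]
    simp [Set.indicator_of_mem h7]

theorem integrable_fourierHat (f : L2R) (hf : Summable fun k => ‖slice k f‖) :
    Integrable (fourierHat f) := by
  refine ⟨(stronglyMeasurable_fourierHat f).aestronglyMeasurable, ?_⟩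
  rw [HasFiniteIntegral, lintegral_eq_tsum_torus]
  have h1 : ∀ k : ℤ, ∫⁻ ξ, ‖fourierHat f (ξ + 2 * Real.pi * k)‖ₑ ∂torusMeasure ≤
      ‖slice k f‖ₑ * torusMeasure Set.univ ^ (1 / 2 : ℝ) := fun k => by
    rw [enorm_slice, ← eLpNorm_one_eq_lintegral_enorm]
    convert eLpNorm_le_eLpNorm_mul_rpow_measure_univ (p := 1) (q := 2) (by norm_num)
      (memLp_slice k f).1 using 3
    norm_num
  refine (ENNReal.tsum_le_tsum h1).trans_lt ?_
  rw [ENNReal.tsum_mul_right]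
  exact ENNReal.mul_lt_top (by rw [tsum_enorm_slice hf]; exact ENNReal.ofReal_lt_top)
    (ENNReal.rpow_lt_top_of_nonneg (by norm_num) (measure_ne_top _ _))

theorem IsContRep.unique {f : L2R} {F G : ℝ → ℂ} (hF : IsContRep f F) (hG : IsContRep f G) :
    F = G :=
  (hF.1.ae_eq_iff_eq volume hG.1).1 (hF.2.symm.trans hG.2)

/-- A function with integrable transform has a continuous representative, given by the inversion
integral. -/
theorem exists_contRep_integral (f : L2R) (hf : Integrable (fourierHat f)) :
    ∃ F, IsContRep f F ∧ ∀ x : ℝ,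
      ∫ ξ : ℝ, Complex.exp (Complex.I * x * ξ) * fourierHat f ξ = (√(2 * Real.pi) : ℝ) * F x := by
  have hpi : (2 * Real.pi) ≠ 0 := by positivity
  have hs : ((√(2 * Real.pi) : ℝ) : ℂ) ≠ 0 := by
    exact_mod_cast (Real.sqrt_pos.2 Real.two_pi_pos).ne'
  have hL : Continuous fun p : ℝ × ℝ => (-innerₗ ℝ) p.1 p.2 :=
    (continuous_inner (𝕜 := ℝ) (E := ℝ)).neg
  have hi : Integrable (𝓕 f : L2R) := by
    refine (((integrable_comp_mul_right_iff _ hpi).2 hf).const_mul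
      ((√(2 * Real.pi) : ℝ) : ℂ)).congr (ae_of_all _ fun η => ?_)
    simp only [fourierHat]
    rw [mul_div_cancel_right₀ _ hpi, mul_inv_cancel_left₀ hs]
  refine ⟨𝓕⁻ (⇑(𝓕 f : L2R)), ⟨?_, ae_eq_fourierInv_of_integrable f hi⟩, fun x => ?_⟩
  · exact VectorFourier.fourierIntegral_continuous Real.continuous_fourierChar hL hi
  · have h1 := Measure.integral_comp_div (fun η : ℝ =>
      Complex.exp (Complex.I * x * (2 * Real.pi * η)) *
      (((√(2 * Real.pi) : ℝ) : ℂ)⁻¹ * (𝓕 f : L2R) η)) (2 * Real.pi)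
    have h2 : ∀ ξ : ℝ, (2 * Real.pi * ((ξ / (2 * Real.pi) : ℝ) : ℂ)) = ξ := fun ξ => by
      exact_mod_cast mul_div_cancel₀ ξ hpi
    simp_rw [h2] at h1
    simp_rw [fourierHat]
    rw [h1, Real.fourierInv_eq', abs_of_pos Real.two_pi_pos, ← integral_smul, ← integral_const_mul]
    congr 1 with η
    rw [Complex.real_smul, smul_eq_mul]
    have h3 : ((2 * Real.pi : ℝ) : ℂ) = (√(2 * Real.pi) : ℝ) * (√(2 * Real.pi) : ℝ) := by
      exact_mod_cast (Real.mul_self_sqrt Real.two_pi_pos.le).symm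
    rw [h3]
    have h4 : Complex.I * x * (2 * Real.pi * η) =
        ((2 * Real.pi * inner ℝ η x : ℝ) : ℂ) * Complex.I := by
      simp
      ring
    rw [h4]
    field_simp

theorem inner_expT_slice (x : ℝ) (k : ℤ) (f : L2R) :
    inner ℂ (expT x k) (slice k f) = ∫ ξ, Complex.exp (Complex.I * x * (ξ + 2 * Real.pi * k)) *
      fourierHat f (ξ + 2 * Real.pi * k) ∂torusMeasure := by
  rw [L2.inner_def]
  refine integral_congr_ae ?_
  filter_upwards [coeFn_slice k f, coeFn_expT x k] with ξ h1 h2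
  rw [h1, h2, RCLike.inner_apply, ← Complex.exp_conj, mul_comm]
  congr 2
  simp only [map_neg, map_mul, map_add, Complex.conj_I, Complex.conj_ofReal, map_ofNat,
    map_intCast]
  ring

/-- Point evaluation in terms of the slices of the transform. -/
theorem exists_contRep (f : L2R) (hf : Summable fun k => ‖slice k f‖) :
    ∃ F, IsContRep f F ∧ ∀ x : ℝ,
      HasSum (fun k : ℤ => inner ℂ (expT x k) (slice k f)) ((√(2 * Real.pi) : ℝ) * F x) := by
  have hi := integrable_fourierHat f hf
  obtain ⟨F, hF, hFx⟩ := exists_contRep_integral f hi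
  refine ⟨F, hF, fun x => ?_⟩
  have hi2 : Integrable fun ξ : ℝ => Complex.exp (Complex.I * x * ξ) * fourierHat f ξ := by
    refine hi.bdd_mul (c := 1) (Continuous.aestronglyMeasurable (by fun_prop))
      (ae_of_all _ fun ξ => ?_)
    rw [Complex.norm_exp]; simp
  rw [← hFx]
  refine (hasSum_integral_torus hi2).congr_fun fun k => ?_
  rw [inner_expT_slice]
  push_cast
  rfl

/-! ### Complete interpolating sequences and Riesz bases of exponentials -/

theorem MemPW.eq_inner {f : L2R} (hf : MemPW f) {F : ℝ → ℂ} (hF : IsContRep f F) (x : ℝ) :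
    (√(2 * Real.pi) : ℝ) * F x = inner ℂ (expT x 0) (slice 0 f) := by
  have h0 := (memPW_iff f).1 hf
  obtain ⟨G, hG, hGx⟩ := exists_contRep f (summable_of_ne_finset_zero (s := {0})
    fun k hk => by rw [h0 k (by simpa using hk), norm_zero])
  rw [hF.unique hG]
  exact (hGx x).unique (hasSum_single 0 fun k hk => by rw [h0 k hk, inner_zero_right])

theorem MemPW.exists_contRep {f : L2R} (hf : MemPW f) : ∃ F, IsContRep f F := by
  have h0 := (memPW_iff f).1 hf
  obtain ⟨G, hG, -⟩ := QuasiShift.exists_contRep f (summable_of_ne_finset_zero (s := {0})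
    fun k hk => by rw [h0 k (by simpa using hk), norm_zero])
  exact ⟨G, hG⟩

/-- In terms of the transform, interpolation in the Paley-Wiener space is the moment problem for
the exponentials on the torus. -/
theorem IsCIS.existsUnique_moment {X : ℤ → ℝ} (hX : IsCIS X) (c : Ell2) :
    ∃! h : L2T, ∀ j, inner ℂ (expT (X j) 0) h = c j := by
  have hs : ((√(2 * Real.pi) : ℝ) : ℂ) ≠ 0 := by
    exact_mod_cast (Real.sqrt_pos.2 Real.two_pi_pos).ne'
  obtain ⟨f, ⟨hf, F, hF, hFx⟩, hu⟩ := hX _ (((√(2 * Real.pi) : ℝ) : ℂ)⁻¹ • c).2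
  have hval : ∀ j, (((√(2 * Real.pi) : ℝ) : ℂ)⁻¹ • c : Ell2) j =
      ((√(2 * Real.pi) : ℝ) : ℂ)⁻¹ * c j :=
    fun j => rfl
  refine ⟨slice 0 f, fun j => ?_, fun h hh => ?_⟩
  · simp only
    rw [← hf.eq_inner hF, hFx, hval, mul_inv_cancel_left₀ hs]
  · obtain ⟨f', hf', rfl⟩ := exists_memPW_slice_zero h
    obtain ⟨F', hF'⟩ := hf'.exists_contRep
    rw [hu f' ⟨hf', F', hF', fun j => ?_⟩]
    rw [hval, ← hh j, ← hf'.eq_inner hF', inv_mul_cancel_left₀ hs]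

theorem norm_expT_sub_le (x y : ℝ) :
    ‖expT x 0 - expT y 0‖ ≤ torusMeasure.real Set.univ ^ (2⁻¹ : ℝ) * (Real.pi * |x - y|) := by
  convert Lp.norm_le_of_ae_bound (p := 2) (f := expT x 0 - expT y 0) (C := Real.pi * |x - y|)
    (by positivity) ?_ using 2
  · have h0 : torusMeasure.real Set.univ = (measureUnivNNReal torusMeasure : ℝ) := rfl
    rw [h0]
    norm_num
  · filter_upwards [Lp.coeFn_sub (expT x 0) (expT y 0), coeFn_expT x 0, coeFn_expT y 0,
      ae_restrict_mem measurableSet_torus] with t h1 h2 h3 h4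
    rw [h1, Pi.sub_apply, h2, h3]
    have h5 : ∀ z : ℝ, Complex.exp (-(Complex.I * z * (t + 2 * Real.pi * (0 : ℤ)))) =
        Complex.exp (-(Complex.I * (y * t : ℝ))) * Complex.exp (Complex.I * ((y - z) * t : ℝ)) := by
      intro z
      rw [← Complex.exp_add]
      congr 1
      push_cast
      ring
    rw [h5 x, h5 y, ← mul_sub, norm_mul, Complex.norm_exp]
    simp only [sub_self, zero_mul, Complex.ofReal_zero, mul_zero, Complex.exp_zero]
    have h6 : (-(Complex.I * (y * t : ℝ))).re = 0 := by simp
    rw [h6, Real.exp_zero, one_mul]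
    refine (Real.norm_exp_I_mul_ofReal_sub_one_le).trans ?_
    rw [norm_mul, Real.norm_eq_abs, Real.norm_eq_abs, abs_sub_comm, mul_comm]
    gcongr
    exact abs_le.2 ⟨h4.1, h4.2.le⟩

/-- A complete interpolating sequence is separated: the solution `h` of the moment problem with data
`1` at `X j` and `0` elsewhere has norm at most `‖R‖`, and `⟪e_j - e_k, h⟫ = 1`, so that `e_j` and
`e_k` cannot be close. -/
theorem IsCIS.separated {X : ℤ → ℝ} (hX : IsCIS X) :
    ∃ a : ℝ, 0 < a ∧ ∀ j k, j ≠ k → a ≤ |X j - X k| := by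
  obtain ⟨R, hR⟩ := exists_momentSolution _ hX.existsUnique_moment
  set K := torusMeasure.real Set.univ ^ (2⁻¹ : ℝ) with hK
  have hK0 : 0 ≤ K := by positivity
  refine ⟨(K * Real.pi * ‖R‖ + 1)⁻¹, by positivity, fun j k hjk => ?_⟩
  have h1 : inner ℂ (expT (X j) 0 - expT (X k) 0) (R (unitVec j)) = 1 := by
    rw [inner_sub_left, hR, hR]
    simp [unitVec, Pi.single_eq_of_ne hjk.symm]
  have h2 := norm_inner_le_norm (𝕜 := ℂ) (expT (X j) 0 - expT (X k) 0) (R (unitVec j))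
  rw [h1, norm_one] at h2
  have h3 : ‖R (unitVec j)‖ ≤ ‖R‖ := by
    refine (R.le_opNorm _).trans_eq ?_
    rw [lp.norm_single (by norm_num)]
    simp
  have h4 := norm_expT_sub_le (X j) (X k)
  rw [inv_le_iff_one_le_mul₀ (by positivity)]
  calc (1 : ℝ) ≤ (K * (Real.pi * |X j - X k|)) * ‖R‖ := h2.trans (by gcongr)
    _ ≤ _ := by nlinarith [abs_nonneg (X j - X k)]

theorem norm_sq_sum_of_orthogonal {E : Type*} [NormedAddCommGroup E] [InnerProductSpace ℂ E]
    {v : ℤ → E} (hv : ∀ j k, j ≠ k → inner ℂ (v j) (v k) = 0) (s : Finset ℤ) (c : ℤ → ℂ) :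
    ‖∑ j ∈ s, c j • v j‖ ^ 2 = ∑ j ∈ s, ‖c j‖ ^ 2 * ‖v j‖ ^ 2 := by
  classical
  induction s using Finset.induction_on with
  | empty => simp
  | insert i s hi ih =>
    have h0 : inner ℂ (c i • v i) (∑ j ∈ s, c j • v j) = 0 := by
      rw [inner_sum]
      refine Finset.sum_eq_zero fun j hj => ?_
      rw [inner_smul_left, inner_smul_right, hv i j (by rintro rfl; exact hi hj)]
      simp
    rw [Finset.sum_insert hi, Finset.sum_insert hi, ← ih, sq, sq,
      norm_add_sq_eq_norm_sq_add_norm_sq_of_inner_eq_zero _ _ h0, norm_smul]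
    ring

open scoped ContDiff in
/-- A function supported in a small interval whose transform is bounded below on the torus. -/
theorem exists_bump {a : ℝ} (ha : 0 < a) :
    ∃ (β : L2R) (m : ℝ), 0 < m ∧ (∀ᵐ x : ℝ, a ≤ |x| → β x = 0) ∧
      ∀ᵐ ξ ∂torusMeasure, m ≤ ‖fourierHat β ξ‖ := by
  -- for `|x| ≤ π⁻¹` and `ξ ∈ 𝕋` the integrand of the transform has real part at least `b x / 2`
  set r := min a Real.pi⁻¹
  have hr0 : 0 < r := lt_min ha (inv_pos.2 Real.pi_pos)
  let b : ContDiffBump (0 : ℝ) := ⟨r / 2, r, half_pos hr0, half_lt_self hr0⟩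
  have hb₁ : HasCompactSupport (Complex.ofRealCLM ∘ b) := b.hasCompactSupport.comp_left rfl
  have hb₂ : ContDiff ℝ ∞ (Complex.ofRealCLM ∘ b) := by
    exact Complex.ofRealCLM.contDiff.comp b.contDiff
  set G := hb₁.toSchwartzMap hb₂
  have hGb : ∀ x, G x = (b x : ℂ) := fun x => rfl
  have hzero : ∀ x, r ≤ |x| → b x = 0 := fun x hx => by
    refine b.zero_of_le_dist ?_
    simpa [b] using hx
  have hint : Integrable b := b.continuous.integrable_of_hasCompactSupport b.hasCompactSupport
  have hpos : 0 < ∫ x, b x := b.integral_pos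
  refine ⟨G.toLp 2, (√(2 * Real.pi))⁻¹ * (2⁻¹ * ∫ x, b x), by positivity, ?_, ?_⟩
  · filter_upwards [G.coeFn_toLp 2 volume] with x hx hax
    rw [hx, hGb, hzero x ((min_le_left _ _).trans hax), Complex.ofReal_zero]
  · have h1 : ∀ᵐ ξ : ℝ, fourierHat (G.toLp 2) ξ =
        ((√(2 * Real.pi) : ℝ) : ℂ)⁻¹ * 𝓕 (G : ℝ → ℂ) (ξ / (2 * Real.pi)) := by
      filter_upwards [quasiMeasurePreserving_div_two_pi.ae ((𝓕 G).coeFn_toLp 2 volume)] with ξ hξ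
      rw [fourierHat, SchwartzMap.toLp_fourier_eq, hξ, SchwartzMap.fourier_coe]
    filter_upwards [ae_restrict_of_ae h1, ae_restrict_mem measurableSet_torus] with ξ h2 h3
    rw [h2, norm_mul, norm_inv, Complex.norm_real, Real.norm_of_nonneg (Real.sqrt_nonneg _)]
    gcongr
    refine le_trans ?_ (Complex.re_le_norm _)
    have hi : Integrable fun v : ℝ => Complex.exp ((↑(-2 * Real.pi * inner ℝ v (ξ / (2 * Real.pi)))
        * Complex.I)) • G v := by
      refine G.integrable.bdd_mul (c := 1) (Continuous.aestronglyMeasurable (by fun_prop))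
        (ae_of_all _ fun v => ?_)
      rw [Complex.norm_exp_ofReal_mul_I]
    rw [Real.fourier_eq', ← RCLike.re_eq_complex_re, ← integral_re hi, ← integral_const_mul]
    refine integral_mono (hint.const_mul _) hi.re fun v => ?_
    have h4 : (-2 * Real.pi * inner ℝ v (ξ / (2 * Real.pi))) = -(v * ξ) := by
      simp
      field_simp
    simp only [h4, hGb, smul_eq_mul, RCLike.re_eq_complex_re, Complex.re_mul_ofReal,
      Complex.exp_ofReal_mul_I_re, Real.cos_neg]
    rcases le_or_gt r |v| with hv | hv
    · rw [hzero v hv]; simp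
    · refine mul_le_mul_of_nonneg_right ?_ b.nonneg
      have h5 : |v * ξ| ≤ 1 := by
        rw [abs_mul]
        calc |v| * |ξ| ≤ Real.pi⁻¹ * Real.pi := by
              gcongr
              · exact hv.le.trans (min_le_right _ _)
              · exact abs_le.2 ⟨h3.1, h3.2.le⟩
          _ = 1 := inv_mul_cancel₀ Real.pi_ne_zero
      have h6 := Real.one_sub_sq_div_two_le_cos (x := v * ξ)
      have h7 := (sq_le_one_iff_abs_le_one _).2 h5
      linarith

/-- The upper Riesz bound for exponentials with separated frequencies. Translates of a bump by the
frequencies have disjoint supports, and the transform of the bump is bounded below on the torus. -/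
theorem exists_bessel_of_separated {X : ℤ → ℝ} {a : ℝ} (ha : 0 < a)
    (hX : ∀ j k, j ≠ k → a ≤ |X j - X k|) :
    ∃ K : ℝ, ∀ (s : Finset ℤ) (c : ℤ → ℂ),
      ‖∑ j ∈ s, c j • expT (X j) 0‖ ^ 2 ≤ K * ∑ j ∈ s, ‖c j‖ ^ 2 := by
  obtain ⟨β, m, hm, hβ, hβm⟩ := exists_bump (half_pos ha)
  have horth : ∀ j k, j ≠ k → inner ℂ (translate (X j) β) (translate (X k) β) = 0 := by
    intro j k hjk
    rw [L2.inner_def]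
    refine integral_eq_zero_of_ae ?_
    filter_upwards [coeFn_translate (X j) β, coeFn_translate (X k) β,
      (measurePreserving_sub_right volume (X j)).quasiMeasurePreserving.ae hβ,
      (measurePreserving_sub_right volume (X k)).quasiMeasurePreserving.ae hβ] with x h1 h2 h3 h4
    rw [h1, h2]
    by_cases h5 : a / 2 ≤ |x - X j|
    · simp [h3 h5]
    · rw [h4, inner_zero_right, Pi.zero_apply]
      have := hX j k hjk
      have h6 := abs_sub_le (X j) x (X k)
      rw [abs_sub_comm (X j) x] at h6
      linarith
  refine ⟨(m⁻¹ * ‖β‖) ^ 2, fun s c => ?_⟩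
  have h1 : ‖∑ j ∈ s, c j • expT (X j) 0‖ ≤ m⁻¹ * ‖slice 0 (∑ j ∈ s, c j • translate (X j) β)‖ := by
    refine Lp.norm_le_mul_norm_of_ae_le_mul ?_
    have h2 : ∀ᵐ ξ ∂torusMeasure, ∀ j, slice 0 (translate (X j) β) ξ =
        fourierHat β ξ * expT (X j) 0 ξ := by
      rw [ae_all_iff]
      intro j
      filter_upwards [slice_translate 0 (X j) β] with ξ hξ
      simpa using hξ
    have h3 : ∀ w : ℤ → L2T, ∀ᵐ ξ ∂torusMeasure,
        (∑ j ∈ s, c j • w j : L2T) ξ = ∑ j ∈ s, c j * w j ξ := by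
      intro w
      classical
      induction s using Finset.induction_on with
      | empty => 
        filter_upwards [Lp.coeFn_zero ℂ 2 torusMeasure] with ξ hξ
        rw [Finset.sum_empty, Finset.sum_empty, hξ]
        rfl
      | insert i s hi ih =>
        rw [Finset.sum_insert hi]
        filter_upwards [ih, Lp.coeFn_add (c i • w i) (∑ j ∈ s, c j • w j),
          Lp.coeFn_smul (c i) (w i)] with ξ h5 h6 h7
        rw [h6, Pi.add_apply, h5, h7, Finset.sum_insert hi]
        rfl
    simp only [map_sum, map_smul]
    filter_upwards [h2, h3 fun j => expT (X j) 0, h3 fun j => slice 0 (translate (X j) β), hβm]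
      with ξ h4 h5 h6 h7
    rw [h5, h6]
    simp_rw [h4, mul_left_comm _ (fourierHat β ξ), ← Finset.mul_sum, norm_mul]
    rw [← mul_assoc]
    refine le_mul_of_one_le_left (norm_nonneg _) ?_
    rwa [← div_eq_inv_mul, one_le_div hm]
  have h2 : ‖slice 0 (∑ j ∈ s, c j • translate (X j) β)‖ ≤ ‖∑ j ∈ s, c j • translate (X j) β‖ :=
    norm_slice_le _ _
  have h3 := norm_sq_sum_of_orthogonal horth s c
  simp_rw [LinearIsometry.norm_map, ← Finset.sum_mul] at h3
  calc _ ≤ (m⁻¹ * ‖∑ j ∈ s, c j • translate (X j) β‖) ^ 2 := by gcongr; exact h1.trans (by gcongr)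
    _ = _ := by rw [mul_pow, h3]; ring

theorem expT_eq_smul (x : ℝ) (k : ℤ) :
    expT x k = Complex.exp (-(Complex.I * x * (2 * Real.pi * k))) • expT x 0 := by
  refine Lp.ext ?_
  filter_upwards [coeFn_expT x k, coeFn_expT x 0, Lp.coeFn_smul
    (Complex.exp (-(Complex.I * x * (2 * Real.pi * k)))) (expT x 0)] with t h1 h2 h3
  rw [h3, Pi.smul_apply, h1, h2, smul_eq_mul, ← Complex.exp_add]
  congr 1
  push_cast
  ring

/-- The prolongation operators of a sequence whose exponentials form a Riesz basis of `L₂(𝕋)`, as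
uniformly bounded operators. -/
structure ProlongOps (X : ℤ → ℝ) where
  /-- The prolongation operators. -/
  A : ℤ → L2T →L[ℂ] L2T
  /-- A common bound for their norms. -/
  κ : ℝ
  prolong_eq : ∀ k h, prolong X k h = A k h
  norm_le : ∀ k, ‖A k‖ ≤ κ
  apply_expT : ∀ k j, A k (expT (X j) 0) = expT (X j) k
  zero_apply : ∀ h, A 0 h = h
  eq_zero_of_inner : ∀ h, (∀ j, inner ℂ (expT (X j) 0) h = 0) → h = 0

/-- For a complete interpolating sequence the prolongation operators are uniformly bounded, because
prolongation multiplies the coefficients with respect to a Riesz basis by unimodular numbers. -/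
theorem IsCIS.nonempty_prolongOps {X : ℤ → ℝ} (hX : IsCIS X) : Nonempty (ProlongOps X) := by
  obtain ⟨a, ha, hsep⟩ := hX.separated
  obtain ⟨K, hK⟩ := exists_bessel_of_separated ha hsep
  have hKk : ∀ (k : ℤ) (s : Finset ℤ) (c : ℤ → ℂ),
      ‖∑ j ∈ s, c j • expT (X j) k‖ ^ 2 ≤ K * ∑ j ∈ s, ‖c j‖ ^ 2 := fun k s c => by
    refine (le_of_eq ?_).trans ((hK s fun j =>
      c j * Complex.exp (-(Complex.I * X j * (2 * Real.pi * k)))).trans_eq ?_)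
    · simp_rw [expT_eq_smul _ k, smul_smul]
    · congr 2 with j
      rw [norm_mul, Complex.norm_exp]
      simp
  choose S hS hSn using fun k => exists_synthesis _ K (hKk k)
  obtain ⟨R, hRS, hSR⟩ := exists_rieszBasis _ hX.existsUnique_moment (S 0) (hS 0)
  have hsum : ∀ (k : ℤ) (c : Ell2), HasSum (fun j => c j • expT (X j) k) (S k c) := fun k c => by
    have := (S k).hasSum (hasSum_smul_unitVec c)
    simpa [hS] using this
  have hcoeff : ∀ h, expCoeff X h = R h := fun h => by
    have H : ∃ c : ℤ → ℂ, Memℓp c 2 ∧ HasSum (fun j => c j • expT (X j) 0) h :=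
      ⟨R h, (R h).2, by simpa [hSR] using hsum 0 (R h)⟩
    have huniq : ∀ c : ℤ → ℂ, Memℓp c 2 → HasSum (fun j => c j • expT (X j) 0) h → c = R h := by
      intro c h1 h2
      have h3 : S 0 ⟨c, h1⟩ = h := (hsum 0 ⟨c, h1⟩).unique h2
      rw [← h3, hRS]
    rw [expCoeff, dif_pos H]
    exact huniq _ H.choose_spec.1 H.choose_spec.2
  have hprol : ∀ k h, prolong X k h = S k (R h) := fun k h => by
    rw [prolong, hcoeff]
    exact (hsum k (R h)).tsum_eq
  refine ⟨fun k => S k ∘L R, √K * ‖R‖, hprol, fun k => ?_, fun k j => ?_, hSR, fun h hh => ?_⟩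
  · exact ((S k).opNorm_comp_le R).trans (by gcongr; exact hSn k)
  · rw [ContinuousLinearMap.comp_apply, ← hS 0, hRS, hS]
  · exact (hX.existsUnique_moment 0).unique hh fun j => by simp

/-! ### The transform of a positive definite function is nonnegative -/

theorem measurePreserving_pair {n : ℕ} (ρ : Measure ℝ) [IsProbabilityMeasure ρ] {i j : Fin n}
    (hij : i ≠ j) :
    MeasurePreserving (fun ω : Fin n → ℝ => (ω i, ω j)) (Measure.pi fun _ => ρ) (ρ.prod ρ) := by
  refine ⟨by fun_prop, ?_⟩
  have h := (ProbabilityTheory.iIndepFun_pi (μ := fun _ : Fin n => ρ) (X := fun _ x => x)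
    (fun _ => aemeasurable_id)).indepFun hij
  rw [ProbabilityTheory.indepFun_iff_map_prod_eq_prod_map_map
    (measurable_pi_apply i).aemeasurable (measurable_pi_apply j).aemeasurable] at h
  rw [h]
  congr 1
  · exact (measurePreserving_eval (fun _ : Fin n => ρ) i).map_eq
  · exact (measurePreserving_eval (fun _ : Fin n => ρ) j).map_eq

/-- Positive definiteness, tested on `n` independent random points and averaged, gives
`n (n - 1) I + n g(0) ≥ 0` for the double integral `I` over two independent points; the
values of `g` on the null set where it differs from `G` drop out, except for `g(0)`,
whose contribution becomes negligible as `n` grows. -/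
theorem IsPosDefFun.integral_prod_nonneg {g G : ℝ → ℂ} (hg : IsPosDefFun g) (hG : Continuous G)
    {B : ℝ} (hB : ∀ x, ‖G x‖ ≤ B) (hgG : g =ᵐ[volume] G) (ρ : Measure ℝ) [IsProbabilityMeasure ρ]
    (hρ : ρ ≪ volume) {a : ℝ → ℂ} (ha : Continuous a) (ha1 : ∀ x, ‖a x‖ = 1) :
    0 ≤ ∫ p : ℝ × ℝ, star (a p.1) * (G (p.1 - p.2) * a p.2) ∂(ρ.prod ρ) := by
  set k : ℝ × ℝ → ℂ := fun p => star (a p.1) * (G (p.1 - p.2) * a p.2) with hk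
  set I := ∫ p, k p ∂(ρ.prod ρ) with hI
  have hkc : Continuous k := by fun_prop
  have hkint : Integrable k (ρ.prod ρ) := by
    refine Integrable.of_bound hkc.aestronglyMeasurable B (ae_of_all _ fun p => ?_)
    simp only [hk, norm_mul, norm_star, ha1, one_mul, mul_one]
    exact hB _
  have haa : ∀ x, star (a x) * a x = 1 := fun x => by
    rw [Complex.star_def, ← Complex.normSq_eq_conj_mul_self, Complex.normSq_eq_norm_sq, ha1]
    simp
  have hnull : ∀ᵐ p ∂(ρ.prod ρ), g (p.1 - p.2) = G (p.1 - p.2) := by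
    refine (hρ.prod hρ).ae_le ?_
    exact (quasiMeasurePreserving_sub_of_right_invariant volume volume).ae hgG
  have key : ∀ m : ℕ, 0 ≤ I + (((m : ℝ) + 1)⁻¹ : ℝ) * g 0 := by
    intro m
    have h1 : ∀ᵐ ω ∂(Measure.pi fun _ : Fin (m + 2) => ρ),
        0 ≤ ∑ i, ∑ j, if i = j then g 0 else k (ω i, ω j) := by
      have h2 : ∀ᵐ ω ∂(Measure.pi fun _ : Fin (m + 2) => ρ), ∀ i j : Fin (m + 2), i ≠ j →
          g (ω i - ω j) = G (ω i - ω j) := by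
        simp_rw [ae_all_iff]
        intro i j hij
        exact (measurePreserving_pair ρ hij).quasiMeasurePreserving.ae hnull
      filter_upwards [h2] with ω hω
      have h3 := (hg (m + 2) ω).dotProduct_mulVec_nonneg (fun i => a (ω i))
      refine h3.trans_eq ?_
      simp only [dotProduct, Matrix.mulVec, Matrix.of_apply, Pi.star_apply, Finset.mul_sum]
      refine Finset.sum_congr rfl fun i _ => Finset.sum_congr rfl fun j _ => ?_
      split_ifs with hij
      · subst hij
        rw [sub_self, mul_left_comm, haa, mul_one]
      · rw [hω i j hij]
    have hint : ∀ i j : Fin (m + 2), Integrable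
        (fun ω : Fin (m + 2) → ℝ => if i = j then g 0 else k (ω i, ω j))
        (Measure.pi fun _ => ρ) := by
      intro i j
      split_ifs with hij
      · exact integrable_const _
      · exact (measurePreserving_pair ρ hij).integrable_comp_of_integrable hkint
    have hval : ∀ i j : Fin (m + 2), ∫ ω : Fin (m + 2) → ℝ, (if i = j then g 0 else k (ω i, ω j))
        ∂(Measure.pi fun _ => ρ) = I + if i = j then g 0 - I else 0 := by
      intro i j
      split_ifs with hij
      · simp
      · rw [add_zero, hI, ← (measurePreserving_pair ρ hij).map_eq, integral_map]
        · fun_prop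
        · exact hkc.aestronglyMeasurable
    have h4 := integral_nonneg_of_ae h1
    rw [integral_finsetSum _ fun i _ => integrable_finsetSum _ fun j _ => hint i j] at h4
    simp_rw [integral_finsetSum _ fun j _ => hint _ j, hval] at h4
    simp only [Finset.sum_add_distrib, Finset.sum_const, Finset.card_univ, Fintype.card_fin,
      Finset.sum_ite_eq, Finset.mem_univ, if_true, nsmul_eq_mul] at h4
    have h5 : (0 : ℂ) ≤ ((((m : ℝ) + 2) * (m + 1))⁻¹ : ℝ) := by
      rw [Complex.zero_le_real]; positivity
    have h6 := mul_nonneg h5 h4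
    refine h6.trans_eq ?_
    have h7 : (m : ℂ) + 1 ≠ 0 := by exact_mod_cast Nat.succ_ne_zero m
    have h8 : (m : ℂ) + 2 ≠ 0 := by exact_mod_cast Nat.succ_ne_zero (m + 1)
    push_cast
    field_simp
    ring
  have hlim : Tendsto (fun m : ℕ => I + (((m : ℝ) + 1)⁻¹ : ℝ) * g 0) atTop
      (𝓝 (I + (0 : ℝ) * g 0)) := by
    refine tendsto_const_nhds.add (Tendsto.mul_const _ ?_)
    refine (Complex.continuous_ofReal.tendsto _).comp ?_
    simpa using tendsto_one_div_add_atTop_nhds_zero_nat (𝕜 := ℝ)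
  simpa using ge_of_tendsto' hlim key

/-- Positive definiteness tested on Gaussian random points with the weights `exp(itx)` says that the
Gaussian averages of the transform are nonnegative. -/
theorem integral_mul_gaussian_nonneg {φ : L2R} (hA1 : CondA1 φ) (hi : Integrable (fourierHat φ))
    {c : ℝ} (hc : 0 < c) (t : ℝ) :
    0 ≤ ∫ ξ, fourierHat φ ξ * Real.exp (-c * (ξ - t) ^ 2) := by
  obtain ⟨g, hgφ, hg⟩ := hA1
  obtain ⟨G, hG, hGx⟩ := exists_contRep_integral φ hi
  set ρ := ProbabilityTheory.gaussianReal 0 c.toNNReal with hρ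
  have hρv : ρ ≪ volume := ProbabilityTheory.gaussianReal_absolutelyContinuous 0
    (Real.toNNReal_pos.2 hc).ne'
  have : IsProbabilityMeasure ρ := by rw [hρ]; infer_instance
  set s := √(2 * Real.pi) with hs
  have hs0 : 0 < s := Real.sqrt_pos.2 Real.two_pi_pos
  have hexp : ∀ x : ℝ, ‖Complex.exp (Complex.I * x)‖ = 1 := fun x => by
    rw [mul_comm, Complex.norm_exp_ofReal_mul_I]
  have hB : ∀ x, ‖G x‖ ≤ s⁻¹ * ∫ ξ, ‖fourierHat φ ξ‖ := fun x => by
    have h1 := congrArg norm (hGx x)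
    rw [norm_mul, Complex.norm_real, Real.norm_of_nonneg hs0.le] at h1
    rw [le_inv_mul_iff₀ hs0, ← h1]
    refine (norm_integral_le_integral_norm _).trans_eq (integral_congr_ae (ae_of_all _ fun ξ => ?_))
    simp only
    rw [norm_mul, mul_assoc, ← Complex.ofReal_mul, hexp, one_mul]
  have h0 := hg.integral_prod_nonneg hG.1 hB (hgφ.symm.trans hG.2) ρ hρv
    (a := fun x : ℝ => Complex.exp (Complex.I * (t * x : ℝ))) (by fun_prop) (fun x => hexp _)
  have h1 : (0 : ℂ) ≤ (s : ℂ) := by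
    rw [Complex.zero_le_real]; positivity
  refine (mul_nonneg h1 h0).trans_eq ?_
  rw [← integral_const_mul]
  have h2 : ∀ p : ℝ × ℝ, (s : ℂ) * (star (Complex.exp (Complex.I * (t * p.1 : ℝ))) *
      (G (p.1 - p.2) * Complex.exp (Complex.I * (t * p.2 : ℝ)))) =
      ∫ ξ, fourierHat φ ξ * (Complex.exp ((ξ - t : ℝ) * p.1 * Complex.I) *
        Complex.exp ((-(ξ - t) : ℝ) * p.2 * Complex.I)) := by
    intro p
    have h3 := hGx (p.1 - p.2)
    calc _ = Complex.exp (Complex.I * (t * (p.2 - p.1) : ℝ)) * ((s : ℂ) * G (p.1 - p.2)) := by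
          rw [Complex.star_def, ← Complex.exp_conj]
          have : Complex.exp (Complex.I * (t * (p.2 - p.1) : ℝ)) =
            Complex.exp ((starRingEnd ℂ) (Complex.I * (t * p.1 : ℝ))) *
              Complex.exp (Complex.I * (t * p.2 : ℝ)) := by
            rw [← Complex.exp_add]
            congr 1
            simp only [map_mul, Complex.conj_I, Complex.conj_ofReal]
            push_cast
            ring
          rw [this]
          ring
      _ = _ := by
          rw [← h3, ← integral_const_mul]
          congr 1 with ξ
          rw [mul_comm (fourierHat φ ξ), ← mul_assoc, ← Complex.exp_add, ← Complex.exp_add]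
          congr 2
          push_cast
          ring
  simp_rw [h2]
  have hint : Integrable (Function.uncurry fun (p : ℝ × ℝ) (ξ : ℝ) => fourierHat φ ξ *
      (Complex.exp ((ξ - t : ℝ) * p.1 * Complex.I) *
        Complex.exp ((-(ξ - t) : ℝ) * p.2 * Complex.I))) ((ρ.prod ρ).prod volume) := by
    have h4 : Integrable (fun q : (ℝ × ℝ) × ℝ => fourierHat φ q.2) ((ρ.prod ρ).prod volume) := by
      simpa using (integrable_const (1 : ℂ) (μ := ρ.prod ρ)).mul_prod hi
    refine h4.mul_bdd (c := 1) (Continuous.aestronglyMeasurable (by fun_prop))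
      (ae_of_all _ fun q => ?_)
    rw [norm_mul, ← Complex.ofReal_mul, ← Complex.ofReal_mul, Complex.norm_exp_ofReal_mul_I,
      Complex.norm_exp_ofReal_mul_I, one_mul]
  rw [integral_integral_swap hint]
  congr 1 with ξ
  rw [integral_const_mul]
  congr 1
  rw [integral_prod_mul (fun x : ℝ => Complex.exp ((ξ - t : ℝ) * x * Complex.I))
    (fun x : ℝ => Complex.exp ((-(ξ - t) : ℝ) * x * Complex.I)),
    ← charFun_apply_real, ← charFun_apply_real, ProbabilityTheory.charFun_gaussianReal,
    ProbabilityTheory.charFun_gaussianReal, ← Complex.exp_add, Complex.ofReal_exp]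
  congr 1
  rw [Real.coe_toNNReal _ hc.le]
  push_cast
  ring

/-- The Gaussians form an approximate identity: away from the endpoints of an interval, the averages
of its indicator function converge to it. -/
theorem tendsto_integral_gaussian_Icc {p q v : ℝ} (hp : v ≠ p) (hq : v ≠ q) :
    Tendsto (fun c : ℝ => ((∫ t in Set.Icc p q,
      √(Real.pi * c) * Real.exp (-(Real.pi ^ 2 * c) * (v - t) ^ 2) : ℝ) : ℂ)) atTop
      (𝓝 ((Set.Icc p q).indicator 1 v)) := by
  have hcont : ContinuousAt ((Set.Icc p q).indicator (1 : ℝ → ℂ)) v := by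
    have hout : v < p ∨ q < v → ContinuousAt ((Set.Icc p q).indicator (1 : ℝ → ℂ)) v := by
      intro h
      have h1 : ∀ᶠ t in 𝓝 v, t ∉ Set.Icc p q := by
        refine isClosed_Icc.isOpen_compl.mem_nhds fun h2 => ?_
        rcases h with h | h
        · exact absurd h2.1 (not_le.2 h)
        · exact absurd h2.2 (not_le.2 h)
      refine (continuousAt_const (y := (0 : ℂ))).congr ?_
      filter_upwards [h1] with t ht
      rw [Set.indicator_of_notMem ht]
    rcases lt_or_gt_of_ne hp with h | h
    · exact hout (Or.inl h)
    rcases lt_or_gt_of_ne hq with h' | h'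
    · refine (continuousAt_const (y := (1 : ℂ))).congr ?_
      filter_upwards [Ioo_mem_nhds h h'] with t ht
      rw [Set.indicator_of_mem (Set.Ioo_subset_Icc_self ht), Pi.one_apply]
    · exact hout (Or.inr h')
  have hint : Integrable ((Set.Icc p q).indicator (1 : ℝ → ℂ)) :=
    (integrable_indicator_iff measurableSet_Icc).2
      (continuous_const (y := (1 : ℂ))).integrableOn_Icc
  refine (Real.tendsto_integral_gaussian_smul' hint hcont).congr' ?_
  filter_upwards [eventually_ge_atTop 0] with c hc
  rw [← integral_complex_ofReal, ← integral_indicator measurableSet_Icc]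
  congr 1 with t
  by_cases ht : t ∈ Set.Icc p q
  · rw [Set.indicator_of_mem ht, Set.indicator_of_mem ht, Pi.one_apply, smul_eq_mul, mul_one,
      Complex.ofReal_mul, Real.sqrt_eq_rpow, Complex.ofReal_cpow (by positivity),
      Complex.ofReal_exp]
    congr 2
    · simp
    · simp
    · have h1 : ((‖v - t‖ : ℝ) : ℂ) ^ 2 = ((v - t) ^ 2 : ℝ) := by
        rw [← Complex.ofReal_pow, Real.norm_eq_abs, sq_abs]
      rw [h1]
      push_cast
      ring
  · simp [ht]

theorem setIntegral_Icc_fourierHat_nonneg {φ : L2R} (hA1 : CondA1 φ)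
    (hi : Integrable (fourierHat φ)) (p q : ℝ) : 0 ≤ ∫ ξ in Set.Icc p q, fourierHat φ ξ := by
  set K : ℝ → ℝ → ℝ → ℝ := fun c ξ t =>
    √(Real.pi * c) * Real.exp (-(Real.pi ^ 2 * c) * (ξ - t) ^ 2) with hK
  have hint : ∀ c : ℝ, 0 < c → Integrable (Function.uncurry fun (t ξ : ℝ) =>
      fourierHat φ ξ * (K c ξ t : ℂ)) ((volume.restrict (Set.Icc p q)).prod volume) := by
    intro c hc
    have h4 : Integrable (fun z : ℝ × ℝ => fourierHat φ z.2)
        ((volume.restrict (Set.Icc p q)).prod volume) := by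
      simpa using (integrable_const (1 : ℂ) (μ := volume.restrict (Set.Icc p q))).mul_prod hi
    refine h4.mul_bdd (c := √(Real.pi * c)) (Continuous.aestronglyMeasurable (by fun_prop))
      (ae_of_all _ fun z => ?_)
    rw [Complex.norm_real, Real.norm_of_nonneg (by positivity)]
    refine mul_le_of_le_one_right (Real.sqrt_nonneg _) (Real.exp_le_one_iff.2 ?_)
    have : 0 ≤ Real.pi ^ 2 * c * (z.2 - z.1) ^ 2 := by positivity
    linarith
  have hpos : ∀ c : ℝ, 0 < c →
      0 ≤ ∫ ξ, fourierHat φ ξ * ((∫ t in Set.Icc p q, K c ξ t : ℝ) : ℂ) := by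
    intro c hc
    have h1 : 0 ≤ ∫ t in Set.Icc p q, ∫ ξ, fourierHat φ ξ * (K c ξ t : ℂ) := by
      refine integral_nonneg fun t => ?_
      have h2 := integral_mul_gaussian_nonneg hA1 hi (c := Real.pi ^ 2 * c) (by positivity) t
      have h3 : (0 : ℂ) ≤ ((√(Real.pi * c) : ℝ) : ℂ) := by
        rw [Complex.zero_le_real]; positivity
      refine (mul_nonneg h3 h2).trans_eq ?_
      rw [← integral_const_mul]
      congr 1 with ξ
      simp only [hK]
      push_cast
      ring
    rw [integral_integral_swap (hint c hc)] at h1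
    refine h1.trans_eq ?_
    congr 1 with ξ
    rw [integral_const_mul, integral_complex_ofReal]
  have hlim : Tendsto (fun c : ℝ => ∫ ξ, fourierHat φ ξ * ((∫ t in Set.Icc p q, K c ξ t : ℝ) : ℂ))
      atTop (𝓝 (∫ ξ, fourierHat φ ξ * (Set.Icc p q).indicator 1 ξ)) := by
    refine tendsto_integral_filter_of_dominated_convergence (fun ξ => ‖fourierHat φ ξ‖) ?_ ?_
      hi.norm ?_
    · filter_upwards [eventually_gt_atTop 0] with c hc
      have := (hint c hc).swap.1.integral_prod_right'
      refine this.congr (ae_of_all _ fun ξ => ?_)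
      simp only [Function.comp_apply, Prod.swap_prod_mk, Function.uncurry_apply_pair]
      rw [integral_const_mul, integral_complex_ofReal]
    · filter_upwards [eventually_gt_atTop 0] with c hc
      refine ae_of_all _ fun ξ => ?_
      rw [norm_mul, Complex.norm_real]
      refine mul_le_of_le_one_right (norm_nonneg _) ?_
      calc ‖∫ t in Set.Icc p q, K c ξ t‖ ≤ ∫ t in Set.Icc p q, ‖K c ξ t‖ :=
            norm_integral_le_integral_norm _
        _ = ∫ t in Set.Icc p q, K c ξ t := by
            congr 1 with t
            exact Real.norm_of_nonneg (by positivity)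
        _ ≤ ∫ t, K c ξ t := by
            refine setIntegral_le_integral ?_ (ae_of_all _ fun t => by positivity)
            exact ((integrable_exp_neg_mul_sq (by positivity)).comp_sub_left ξ).const_mul _
        _ = 1 := by
            rw [integral_const_mul, integral_sub_left_eq_self
              (fun u => Real.exp (-(Real.pi ^ 2 * c) * u ^ 2)) volume ξ, integral_gaussian,
              ← Real.sqrt_mul (by positivity), Real.sqrt_eq_one]
            field_simp
    · filter_upwards [Measure.ae_ne volume p, Measure.ae_ne volume q] with ξ h1 h2
      exact (tendsto_integral_gaussian_Icc h1 h2).const_mul _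
  have h3 := ge_of_tendsto hlim (eventually_atTop.2 ⟨1, fun c hc => hpos c (by linarith)⟩)
  refine h3.trans_eq ?_
  rw [← integral_indicator measurableSet_Icc]
  congr 1 with ξ
  by_cases h : ξ ∈ Set.Icc p q <;> simp [h]

/-- The Fourier transform of a positive definite function is nonnegative. By Lebesgue's
differentiation theorem it is enough that the integrals over intervals are nonnegative. -/
theorem fourierHat_nonneg {φ : L2R} (hA1 : CondA1 φ) (hi : Integrable (fourierHat φ)) :
    ∀ᵐ ξ, 0 ≤ fourierHat φ ξ := by
  filter_upwards [IsUnifLocDoublingMeasure.ae_tendsto_average (μ := volume)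
    hi.locallyIntegrable 1] with x hx
  have h1 := hx (l := 𝓝[>] (0 : ℝ)) (fun _ => x) (fun r => r) tendsto_id (by
    filter_upwards [self_mem_nhdsWithin] with r hr
    rw [one_mul]
    exact Metric.mem_closedBall_self (le_of_lt hr))
  refine ge_of_tendsto h1 (Eventually.of_forall fun r => ?_)
  rw [setAverage_eq, Real.closedBall_eq_Icc]
  exact smul_nonneg (by positivity) (setIntegral_Icc_fourierHat_nonneg hA1 hi _ _)

/-! ### The multiplication operators of a generator -/

/-- The operators `M_φ` and `T_{φ,k}` of a generator `φ`, as bounded operators, with the bounds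
and the positivity that (A1) and (A2) imply. -/
structure SymbolOps (φ : L2R) where
  /-- The operator `M_φ`. -/
  M : L2T →L[ℂ] L2T
  /-- The operators `T_{φ,k}`. -/
  T : ℤ → L2T →L[ℂ] L2T
  /-- Bounds for the norms of the operators `T_{φ,k}`. -/
  τ : ℤ → ℝ
  /-- The number `δ_φ`. -/
  δ : ℝ
  δ_pos : 0 < δ
  opM_eq : ∀ g, opM φ g = M g
  opT_eq : ∀ k g, opT φ k g = T k g
  norm_M_le : ‖M‖ ≤ 1
  T_M : ∀ g, T 0 (M g) = g
  M_T : ∀ g, M (T 0 g) = g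
  norm_T_le : ∀ k, ‖T k‖ ≤ τ k
  summable_τ : Summable τ
  tsum_τ : ∑' k : {k : ℤ // k ≠ 0}, τ k = (ratioConst φ).toReal
  re_inner_T_nonneg : ∀ k h, 0 ≤ RCLike.re (inner ℂ (T k h) h)
  le_re_inner_T : ∀ h, ‖h‖ ^ 2 ≤ RCLike.re (inner ℂ (T 0 h) h)
  slice_translate_eq : ∀ k x, slice k (translate x φ) = (δ : ℂ) • T k (expT x k)

theorem ae_norm_le_supNormAt {g : ℝ → ℂ} {k : ℤ} (h : supNormAt g k ≠ ⊤) :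
    ∀ᵐ ξ ∂torusMeasure, ‖g (ξ + 2 * Real.pi * k)‖ ≤ (supNormAt g k).toReal := by
  rw [supNormAt, eLpNorm_exponent_top] at h ⊢
  filter_upwards [ae_le_eLpNormEssSup (f := fun ξ => g (ξ + 2 * Real.pi * k))
    (μ := torusMeasure)] with ξ hξ
  rw [← toReal_enorm]
  exact ENNReal.toReal_mono h hξ

theorem torusMeasure_ne_zero : torusMeasure ≠ 0 := by
  intro h
  have := congrArg (fun μ => μ Set.univ) h
  simp [torus, Real.volume_Ico] at this
  linarith [Real.pi_pos]

theorem integrable_of_memWiener {g : ℝ → ℂ} (hg : MemWiener g) : Integrable g := by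
  refine ⟨hg.1, ?_⟩
  rw [HasFiniteIntegral, lintegral_eq_tsum_torus]
  have h1 : ∀ k : ℤ, ∫⁻ ξ, ‖g (ξ + 2 * Real.pi * k)‖ₑ ∂torusMeasure ≤
      supNormAt g k * torusMeasure Set.univ := fun k => by
    rw [supNormAt, eLpNorm_exponent_top, ← lintegral_const]
    exact lintegral_mono_ae (ae_le_eLpNormEssSup (f := fun ξ => g (ξ + 2 * Real.pi * k)))
  refine (ENNReal.tsum_le_tsum h1).trans_lt ?_
  rw [ENNReal.tsum_mul_right]
  exact ENNReal.mul_lt_top hg.2 (measure_lt_top _ _)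

theorem nonempty_symbolOps {φ : L2R} (hA1 : CondA1 φ) (hA2 : CondA2 φ) :
    Nonempty (SymbolOps φ) := by
  obtain ⟨hW, hδ, -⟩ := hA2
  have hpos := fourierHat_nonneg hA1 (integrable_of_memWiener hW)
  have hsup : ∀ k, supNormAt (fourierHat φ) k ≠ ⊤ := ENNReal.ne_top_of_tsum_ne_top hW.2.ne
  have hle := fun k => ae_norm_le_supNormAt (hsup k)
  have hδle : ∀ᵐ ξ ∂torusMeasure, delta φ ≤ ‖fourierHat φ ξ‖ₑ := ae_essInf_le
  have : (ae torusMeasure).NeBot := ae_neBot.2 torusMeasure_ne_zero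
  have hδtop : delta φ ≠ ⊤ := by
    obtain ⟨ξ, hξ⟩ := hδle.exists
    exact (hξ.trans_lt enorm_lt_top).ne
  set D := (delta φ).toReal 
  have hD0 : 0 < D := ENNReal.toReal_pos hδ.ne' hδtop
  have hDle : ∀ᵐ ξ ∂torusMeasure, D ≤ ‖fourierHat φ ξ‖ := by
    filter_upwards [hδle] with ξ hξ
    rw [← toReal_enorm]
    exact ENNReal.toReal_mono enorm_ne_top hξ
  have hmeas : ∀ k : ℤ, AEStronglyMeasurable (fun ξ => fourierHat φ (ξ + 2 * Real.pi * k))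
      torusMeasure := fun k => ((stronglyMeasurable_fourierHat φ).comp_measurable
        (measurable_id.add_const _)).aestronglyMeasurable
  have hDc : (D : ℂ) ≠ 0 := by exact_mod_cast hD0.ne'
  have hmM : AEStronglyMeasurable (fun ξ => (D : ℂ) / fourierHat φ ξ) torusMeasure :=
    ((measurable_const).div (stronglyMeasurable_fourierHat φ).measurable).aestronglyMeasurable
  have hbM : ∀ᵐ ξ ∂torusMeasure, ‖(D : ℂ) / fourierHat φ ξ‖ ≤ 1 := by
    filter_upwards [hDle] with ξ hξ
    rw [norm_div, Complex.norm_real, Real.norm_of_nonneg hD0.le]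
    exact div_le_one_of_le₀ hξ (norm_nonneg _)
  have hmT : ∀ k : ℤ, AEStronglyMeasurable
      (fun ξ => (D : ℂ)⁻¹ * fourierHat φ (ξ + 2 * Real.pi * k)) torusMeasure :=
    fun k => (hmeas k).const_mul _
  have hbT : ∀ k : ℤ, ∀ᵐ ξ ∂torusMeasure, ‖(D : ℂ)⁻¹ * fourierHat φ (ξ + 2 * Real.pi * k)‖ ≤
      (supNormAt (fourierHat φ) k).toReal / D := by
    intro k
    filter_upwards [hle k] with ξ hξ
    rw [norm_mul, norm_inv, Complex.norm_real, Real.norm_of_nonneg hD0.le, div_eq_inv_mul]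
    gcongr
  -- the quadratic form of a multiplication operator is the integral of its symbol
  have hinner : ∀ (k : ℤ) (h : L2T),
      inner ℂ (mulCLM _ _ (hmT k) (hbT k) h) h = ∫ ξ, star ((D : ℂ)⁻¹ *
        fourierHat φ (ξ + 2 * Real.pi * k)) * (star (h ξ) * h ξ) ∂torusMeasure := by
    intro k h
    rw [L2.inner_def]
    refine integral_congr_ae ?_
    filter_upwards [coeFn_mulCLM (hmT k) (hbT k) h] with ξ hξ
    rw [hξ, RCLike.inner_apply]
    simp
    ring
  refine ⟨⟨mulCLM _ 1 hmM hbM, fun k => mulCLM _ _ (hmT k) (hbT k),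
    fun k => (supNormAt (fourierHat φ) k).toReal / D, D, hD0, fun g => ?_, fun k g => ?_, ?_,
    fun g => ?_, fun g => ?_, fun k => ?_, ?_, ?_, fun k h => ?_, fun h => ?_, fun k x => ?_⟩⟩
  · exact mulT_eq_mulCLM hmM hbM g
  · exact mulT_eq_mulCLM (hmT k) (hbT k) g
  · exact norm_mulCLM_le hmM hbM zero_le_one
  · refine Lp.ext ?_
    filter_upwards [coeFn_mulCLM (hmT 0) (hbT 0) (mulCLM _ 1 hmM hbM g), coeFn_mulCLM hmM hbM g,
      hDle] with ξ h1 h2 h3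
    have h4 : fourierHat φ ξ ≠ 0 := norm_pos_iff.1 (hD0.trans_le h3)
    rw [h1, h2]
    simp only [Int.cast_zero, mul_zero, add_zero]
    field_simp
  · refine Lp.ext ?_
    filter_upwards [coeFn_mulCLM hmM hbM (mulCLM _ _ (hmT 0) (hbT 0) g),
      coeFn_mulCLM (hmT 0) (hbT 0) g, hDle] with ξ h1 h2 h3
    have h4 : fourierHat φ ξ ≠ 0 := norm_pos_iff.1 (hD0.trans_le h3)
    rw [h1, h2]
    simp only [Int.cast_zero, mul_zero, add_zero]
    field_simp
  · exact norm_mulCLM_le (hmT k) (hbT k) (by positivity)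
  · exact (ENNReal.summable_toReal hW.2.ne).div_const _
  · rw [ratioConst, ENNReal.toReal_div, ENNReal.tsum_toReal_eq
      (f := fun k : {k : ℤ // k ≠ 0} => supNormAt (fourierHat φ) k) fun k => hsup k, tsum_div_const]
  · have h1 : 0 ≤ inner ℂ (mulCLM _ _ (hmT k) (hbT k) h) h := by
      rw [hinner]
      refine integral_nonneg_of_ae ?_
      filter_upwards [ae_iff_forall_torus.1 hpos k] with ξ hξ
      refine mul_nonneg (star_nonneg_iff.2 (mul_nonneg ?_ hξ)) (star_mul_self_nonneg _)
      rw [← Complex.ofReal_inv, Complex.zero_le_real]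
      positivity
    exact (RCLike.nonneg_iff.1 h1).1
  · have h1 : 0 ≤ inner ℂ (mulCLM _ _ (hmT 0) (hbT 0) h - h) h := by
      rw [L2.inner_def]
      refine integral_nonneg_of_ae ?_
      filter_upwards [ae_restrict_of_ae hpos, hDle, coeFn_mulCLM (hmT 0) (hbT 0) h,
        Lp.coeFn_sub (mulCLM _ _ (hmT 0) (hbT 0) h) h] with ξ h2 h3 h4 h5
      rw [h5, Pi.sub_apply, h4, RCLike.inner_apply]
      simp only [Int.cast_zero, mul_zero, add_zero]
      have h6 : fourierHat φ ξ = (‖fourierHat φ ξ‖ : ℝ) := (RCLike.norm_of_nonneg' h2).symm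
      have h7 : h ξ * (starRingEnd ℂ) ((D : ℂ)⁻¹ * fourierHat φ ξ * h ξ - h ξ) =
          ((D⁻¹ * ‖fourierHat φ ξ‖ - 1 : ℝ) : ℂ) * (star (h ξ) * h ξ) := by
        rw [h6]
        simp
        ring
      rw [h7]
      refine mul_nonneg ?_ (star_mul_self_nonneg _)
      rw [Complex.zero_le_real, sub_nonneg, ← div_eq_inv_mul, one_le_div hD0]
      exact h3
    have h2 := (RCLike.nonneg_iff.1 h1).1
    rw [inner_sub_left, map_sub, sub_nonneg] at h2
    rwa [← inner_self_eq_norm_sq (𝕜 := ℂ)]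
  · refine Lp.ext ?_
    filter_upwards [slice_translate k x φ, coeFn_mulCLM (hmT k) (hbT k) (expT x k),
      Lp.coeFn_smul (D : ℂ) (mulCLM _ _ (hmT k) (hbT k) (expT x k))] with ξ h1 h2 h3
    rw [h1, h3, Pi.smul_apply, h2, smul_eq_mul]
    field_simp

/-! ### Quasi shift-invariant spaces in terms of slices -/

section Space

variable {φ : L2R} {Y : ℤ → ℝ}

theorem ProlongOps.κ_nonneg (Q : ProlongOps Y) : 0 ≤ Q.κ := (norm_nonneg _).trans (Q.norm_le 0)

theorem SymbolOps.τ_nonneg (S : SymbolOps φ) (k : ℤ) : 0 ≤ S.τ k :=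
  (norm_nonneg _).trans (S.norm_T_le k)

theorem norm_T_A_le (S : SymbolOps φ) (Q : ProlongOps Y) (k : ℤ) (h : L2T) :
    ‖S.T k (Q.A k h)‖ ≤ S.τ k * (Q.κ * ‖h‖) :=
  ((S.T k).le_of_opNorm_le (S.norm_T_le k) _).trans <|
    mul_le_mul_of_nonneg_left ((Q.A k).le_of_opNorm_le (Q.norm_le k) h) (S.τ_nonneg k)

theorem norm_M_le (S : SymbolOps φ) (g : L2T) : ‖S.M g‖ ≤ ‖g‖ := by
  simpa using S.M.le_of_opNorm_le S.norm_M_le g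

theorem translate_mem_quasiShiftSpace (φ : L2R) (Y : ℤ → ℝ) (j : ℤ) :
    translate (Y j) φ ∈ quasiShiftSpace φ Y :=
  Submodule.le_topologicalClosure _ (Submodule.subset_span ⟨j, coeFn_translate _ _⟩)

/-- A closed subspace that contains the translates of `φ` by the `Y j` contains `V(φ, Y)`. -/
theorem quasiShiftSpace_le {φ : L2R} {Y : ℤ → ℝ} {W : Submodule ℂ L2R}
    (hW : IsClosed (W : Set L2R)) (h : ∀ j, translate (Y j) φ ∈ W) : quasiShiftSpace φ Y ≤ W := by
  refine Submodule.topologicalClosure_minimal _ (Submodule.span_le.2 ?_) hW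
  rintro u ⟨j, hu⟩
  have : u = translate (Y j) φ := Lp.ext (hu.trans (coeFn_translate _ _).symm)
  rw [this]
  exact h j

/-- A function in `V(φ, Y)` is determined by the restriction of its transform to the torus. -/
theorem slice_eq_of_mem (S : SymbolOps φ) (Q : ProlongOps Y) {f : L2R}
    (hf : f ∈ quasiShiftSpace φ Y) (k : ℤ) :
    slice k f = S.T k (Q.A k (S.M (slice 0 f))) := by
  have := quasiShiftSpace_le (φ := φ) (Y := Y)
    (W := LinearMap.ker (slice k - S.T k ∘L Q.A k ∘L S.M ∘L slice 0).toLinearMap)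
    (ContinuousLinearMap.isClosed_ker _) (fun j => ?_) hf
  · exact sub_eq_zero.1 this
  · change slice k _ - S.T k (Q.A k (S.M (slice 0 _))) = 0
    rw [S.slice_translate_eq, S.slice_translate_eq, map_smul, S.M_T, map_smul, map_smul,
      Q.apply_expT, sub_self]

theorem summable_norm_slice (S : SymbolOps φ) (Q : ProlongOps Y) {f : L2R}
    (hf : f ∈ quasiShiftSpace φ Y) :
    Summable fun k => ‖slice k f‖ := by
  refine Summable.of_nonneg_of_le (fun _ => norm_nonneg _) (fun k => ?_)
    (S.summable_τ.mul_right (Q.κ * ‖S.M (slice 0 f)‖))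
  rw [slice_eq_of_mem S Q hf]
  exact norm_T_A_le S Q k _

theorem norm_le_of_mem (S : SymbolOps φ) (Q : ProlongOps Y) {f : L2R}
    (hf : f ∈ quasiShiftSpace φ Y) :
    ‖f‖ ≤ (∑' k, S.τ k) * Q.κ * ‖slice 0 f‖ := by
  refine (norm_le_tsum_slice (summable_norm_slice S Q hf)).trans ?_
  rw [← tsum_mul_right, ← tsum_mul_right]
  refine (summable_norm_slice S Q hf).tsum_le_tsum (fun k => ?_)
    ((S.summable_τ.mul_right _).mul_right _)
  rw [slice_eq_of_mem S Q hf, mul_assoc]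
  refine (norm_T_A_le S Q k _).trans ?_
  gcongr
  · exact S.τ_nonneg k
  · exact Q.κ_nonneg
  · exact norm_M_le S _

/-- Every element of `L₂(𝕋)` is the restriction of the transform of a function in `V(φ, Y)`: the
restriction map is bounded below on `V(φ, Y)`, so that its range is closed, and the range is dense
because `φ̂` is invertible on the torus and the exponentials are complete. -/
theorem exists_mem_slice_zero_eq (S : SymbolOps φ) (Q : ProlongOps Y) (g : L2T) :
    ∃ f ∈ quasiShiftSpace φ Y, slice 0 f = g := by
  set V := quasiShiftSpace φ Y
  let L : V →L[ℂ] L2T := slice 0 ∘L V.subtypeL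
  have hVc : IsClosed (V : Set L2R) := Submodule.isClosed_topologicalClosure _
  have : CompleteSpace V := hVc.completeSpace_coe
  set C := (∑' k, S.τ k) * Q.κ with hC
  have hC0 : 0 ≤ C := mul_nonneg (tsum_nonneg S.τ_nonneg) Q.κ_nonneg
  have hanti : AntilipschitzWith C.toNNReal L := L.antilipschitz_of_bound fun v => by
    rw [Real.coe_toNNReal _ hC0]
    exact norm_le_of_mem S Q v.2
  have hcl : IsClosed (LinearMap.range L.toLinearMap : Set L2T) := by
    rw [LinearMap.coe_range]
    exact hanti.isClosed_range L.uniformContinuous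
  have : CompleteSpace (LinearMap.range L.toLinearMap) := hcl.completeSpace_coe
  have htop : LinearMap.range L.toLinearMap = ⊤ := by
    rw [← Submodule.orthogonal_eq_bot_iff, Submodule.eq_bot_iff]
    intro z hz
    have h1 : ∀ j, inner ℂ (expT (Y j) 0) ((S.T 0).adjoint z) = 0 := by
      intro j
      have h2 : inner ℂ (slice 0 (translate (Y j) φ)) z = 0 :=
        hz _ ⟨⟨_, translate_mem_quasiShiftSpace φ Y j⟩, rfl⟩
      have h3 : ((starRingEnd ℂ) S.δ) ≠ 0 := by
        rw [Complex.conj_ofReal]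
        exact_mod_cast S.δ_pos.ne'
      rw [S.slice_translate_eq, inner_smul_left] at h2
      rw [ContinuousLinearMap.adjoint_inner_right]
      exact (mul_eq_zero.1 h2).resolve_left h3
    have h4 := Q.eq_zero_of_inner _ h1
    have h5 : inner ℂ (S.T 0 (S.M z)) z = 0 := by
      rw [← ContinuousLinearMap.adjoint_inner_right, h4, inner_zero_right]
    rwa [S.T_M, inner_self_eq_zero] at h5
  obtain ⟨v, hv⟩ := LinearMap.range_eq_top.1 htop g
  exact ⟨v, v.2, hv⟩

/-! ### Interpolation as an operator equation -/

/-- The element of `L₂(𝕋)` whose moments against the exponentials are the samples on `Y`, up to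
the factor `√(2π)`. -/
def sampling (Q : ProlongOps Y) (f : L2R) : L2T := ∑' k, (Q.A k).adjoint (slice k f)

theorem norm_adjoint_A_le (Q : ProlongOps Y) (k : ℤ) (h : L2T) : ‖(Q.A k).adjoint h‖ ≤ Q.κ * ‖h‖ :=
  (Q.A k).adjoint.le_of_opNorm_le
    ((LinearIsometryEquiv.norm_map ContinuousLinearMap.adjoint (Q.A k)).trans_le (Q.norm_le k)) h

theorem summable_adjoint (Q : ProlongOps Y) {w : ℤ → L2T} (hw : Summable fun k => ‖w k‖) :
    Summable fun k => (Q.A k).adjoint (w k) :=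
  Summable.of_norm_bounded (hw.mul_left Q.κ) fun k => norm_adjoint_A_le Q k _

theorem inner_sampling (Q : ProlongOps Y) {f : L2R} (hf : Summable fun k => ‖slice k f‖) {F : ℝ → ℂ}
    (hF : IsContRep f F) (j : ℤ) :
    inner ℂ (expT (Y j) 0) (sampling Q f) = (√(2 * Real.pi) : ℝ) * F (Y j) := by
  obtain ⟨G, hG, hGx⟩ := exists_contRep f hf
  rw [hF.unique hG, sampling]
  have h1 := (innerSL ℂ (expT (Y j) 0)).hasSum (summable_adjoint Q hf).hasSum
  refine h1.unique ((hGx (Y j)).congr_fun fun k => ?_)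
  rw [innerSL_apply_apply, ContinuousLinearMap.adjoint_inner_right, Q.apply_expT]

theorem interpolates_iff (Q : ProlongOps Y) {f u : L2R} (hf : Summable fun k => ‖slice k f‖)
    (hu : Summable fun k => ‖slice k u‖) :
    Interpolates Y f u ↔ sampling Q u = sampling Q f := by
  have hs : ((√(2 * Real.pi) : ℝ) : ℂ) ≠ 0 := by
    exact_mod_cast (Real.sqrt_pos.2 Real.two_pi_pos).ne'
  constructor
  · rintro ⟨F, U, hF, hU, h⟩
    refine sub_eq_zero.1 (Q.eq_zero_of_inner _ fun j => ?_)
    rw [inner_sub_right, inner_sampling Q hu hU, inner_sampling Q hf hF, h, sub_self]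
  · intro h
    obtain ⟨F, hF, -⟩ := exists_contRep f hf
    obtain ⟨U, hU, -⟩ := exists_contRep u hu
    refine ⟨F, U, hF, hU, fun j => mul_left_cancel₀ hs ?_⟩
    rw [← inner_sampling Q hu hU, ← inner_sampling Q hf hF, h]

theorem tsum_eq_zero_add_tsum_ne {E : Type*} [NormedAddCommGroup E] [CompleteSpace E] {w : ℤ → E}
    (hw : Summable w) : ∑' k, w k = w 0 + ∑' k : {k : ℤ // k ≠ 0}, w k := by
  have := (hw.tsum_subtype_add_tsum_subtype_compl {0}).symm
  rw [this, tsum_singleton]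
  rfl

/-- The operator `P = ∑ₖ (A_Y^k)* T_{φ,k} A_Y^k`, through which the function in `V(φ, Y)` whose
transform is `T_{φ,0} h` on the torus is sampled. -/
def gram (S : SymbolOps φ) (Q : ProlongOps Y) : L2T →L[ℂ] L2T :=
  ∑' k, (Q.A k).adjoint ∘L S.T k ∘L Q.A k

theorem hasSum_apply_of_norm_le {E : Type*} [NormedAddCommGroup E] [NormedSpace ℂ E]
    [CompleteSpace E] {B : ℤ → E →L[ℂ] E} {b : ℤ → ℝ} (hb : Summable b)
    (hB : ∀ k x, ‖B k x‖ ≤ b k * ‖x‖) (hb0 : ∀ k, 0 ≤ b k) (h : E) :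
    HasSum (fun k => B k h) ((∑' k, B k) h) := by
  have hs : Summable B := Summable.of_norm_bounded hb fun k =>
    (B k).opNorm_le_bound (hb0 k) (hB k)
  exact (ContinuousLinearMap.apply ℂ E h).hasSum hs.hasSum

theorem hasSum_gram (S : SymbolOps φ) (Q : ProlongOps Y) (h : L2T) :
    HasSum (fun k => (Q.A k).adjoint (S.T k (Q.A k h))) (gram S Q h) := by
  refine hasSum_apply_of_norm_le ((S.summable_τ.mul_right Q.κ).mul_left Q.κ) (fun k x => ?_)
    (fun k => mul_nonneg Q.κ_nonneg (mul_nonneg (S.τ_nonneg k) Q.κ_nonneg)) h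
  refine (norm_adjoint_A_le Q k _).trans ?_
  rw [mul_assoc, mul_assoc]
  exact mul_le_mul_of_nonneg_left (norm_T_A_le S Q k x) Q.κ_nonneg

theorem gram_coercive (S : SymbolOps φ) (Q : ProlongOps Y) (h : L2T) :
    ‖h‖ ^ 2 ≤ RCLike.re (inner ℂ (gram S Q h) h) := by
  have h1 : HasSum (fun k => RCLike.re (inner ℂ h ((Q.A k).adjoint (S.T k (Q.A k h)))))
      (RCLike.re (inner ℂ h (gram S Q h))) :=
    RCLike.hasSum_re ℂ ((innerSL ℂ h).hasSum (hasSum_gram S Q h))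
  have h2 : ∀ k, RCLike.re (inner ℂ h ((Q.A k).adjoint (S.T k (Q.A k h)))) =
      RCLike.re (inner ℂ (S.T k (Q.A k h)) (Q.A k h)) := fun k => by
    rw [ContinuousLinearMap.adjoint_inner_right, inner_re_symm]
  simp_rw [h2] at h1
  rw [inner_re_symm]
  refine (S.le_re_inner_T h).trans ?_
  have h3 := le_hasSum h1 0 fun k _ => S.re_inner_T_nonneg k _
  rwa [Q.zero_apply] at h3

theorem sampling_eq_gram (S : SymbolOps φ) (Q : ProlongOps Y) {u : L2R}
    (hu : u ∈ quasiShiftSpace φ Y) :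
    sampling Q u = gram S Q (S.M (slice 0 u)) := by
  rw [sampling, ← (hasSum_gram S Q _).tsum_eq]
  exact tsum_congr fun k => by rw [← slice_eq_of_mem S Q hu]

theorem norm_tsum_ne_adjoint_le (Q : ProlongOps Y) {w : ℤ → L2T} (hw : Summable fun k => ‖w k‖) :
    ‖∑' k : {k : ℤ // k ≠ 0}, (Q.A k).adjoint (w k)‖ ≤
      Q.κ * ∑' k : {k : ℤ // k ≠ 0}, ‖w k‖ := by
  have h1 : Summable fun k : {k : ℤ // k ≠ 0} => ‖w k‖ := hw.subtype _
  rw [← tsum_mul_left]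
  exact tsum_of_norm_bounded (h1.mul_left Q.κ).hasSum fun k => norm_adjoint_A_le Q k _

/-- The inverse of `P M_φ` has norm at most `1 + κ² C_φ`: a solution of `P M_φ d = s` satisfies
`‖M_φ d‖ ≤ ‖s‖` by coercivity, and `d = s - ∑_{k ≠ 0} (A_Y^k)* T_{φ,k} A_Y^k M_φ d`. The size of
`M_φ⁻¹`, for which no uniform bound over a family of generators is available, does not enter. -/
theorem norm_le_of_gram_M (S : SymbolOps φ) (Q : ProlongOps Y) (d : L2T) :
    ‖d‖ ≤ (1 + Q.κ ^ 2 * (ratioConst φ).toReal) * ‖gram S Q (S.M d)‖ := by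
  set h := S.M d with hh
  set s := gram S Q h with hs
  have h1 : ‖h‖ ≤ ‖s‖ := by
    by_contra! hlt
    have h2 := gram_coercive S Q h
    have h3 : RCLike.re (inner ℂ (gram S Q h) h) ≤ ‖gram S Q h‖ * ‖h‖ := re_inner_le_norm _ _
    have h4 : 0 < ‖h‖ := (norm_nonneg _).trans_lt hlt
    nlinarith
  have hw : Summable fun k => ‖S.T k (Q.A k h)‖ :=
    Summable.of_nonneg_of_le (fun _ => norm_nonneg _) (fun k => norm_T_A_le S Q k h)
      (S.summable_τ.mul_right _)
  have h2 : s = d + ∑' k : {k : ℤ // k ≠ 0}, (Q.A k).adjoint (S.T k (Q.A k h)) := by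
    have h3 := (hasSum_gram S Q h).tsum_eq
    rw [tsum_eq_zero_add_tsum_ne (hasSum_gram S Q h).summable] at h3
    have h4 : (Q.A 0).adjoint (S.T 0 (Q.A 0 h)) = d := by
      refine ext_inner_left ℂ fun v => ?_
      rw [ContinuousLinearMap.adjoint_inner_right, Q.zero_apply, Q.zero_apply, S.T_M]
    rw [h4] at h3
    exact h3.symm
  have h3 : ∑' k : {k : ℤ // k ≠ 0}, ‖S.T k (Q.A k h)‖ ≤
      (ratioConst φ).toReal * (Q.κ * ‖h‖) := by
    rw [← S.tsum_τ, ← tsum_mul_right]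
    exact (hw.subtype _).tsum_le_tsum (fun k => norm_T_A_le S Q k h)
      ((S.summable_τ.subtype _).mul_right _)
  have h4 := norm_tsum_ne_adjoint_le Q hw
  have hκ := Q.κ_nonneg
  have hC : 0 ≤ (ratioConst φ).toReal := ENNReal.toReal_nonneg
  calc ‖d‖ = ‖s - ∑' k : {k : ℤ // k ≠ 0}, (Q.A k).adjoint (S.T k (Q.A k h))‖ := by
        rw [h2, add_sub_cancel_right]
    _ ≤ ‖s‖ + Q.κ * ((ratioConst φ).toReal * (Q.κ * ‖s‖)) := by
        refine (norm_sub_le _ _).trans ?_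
        gcongr
        exact h4.trans (by gcongr; exact h3.trans (by gcongr))
    _ = _ := by ring

/-- Unique solvability of the interpolation problem in `V(φ, Y)`. -/
theorem existsUnique_interpolates (S : SymbolOps φ) (Q : ProlongOps Y) {f : L2R}
    (hf : Summable fun k => ‖slice k f‖) :
    ∃! u : L2R, u ∈ quasiShiftSpace φ Y ∧ Interpolates Y f u := by
  obtain ⟨h, hh⟩ := surjective_of_coercive (gram S Q) (gram_coercive S Q) (sampling Q f)
  obtain ⟨u, hu, hu0⟩ := exists_mem_slice_zero_eq S Q (S.T 0 h)
  refine ⟨u, ⟨hu, ?_⟩, fun v ⟨hv, hvf⟩ => ?_⟩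
  · rw [interpolates_iff Q hf (summable_norm_slice S Q hu), sampling_eq_gram S Q hu, hu0, S.M_T, hh]
  · rw [interpolates_iff Q hf (summable_norm_slice S Q hv), sampling_eq_gram S Q hv, ← hh,
      ← S.M_T h, ← hu0, ← sub_eq_zero, ← map_sub, ← map_sub, ← map_sub] at hvf
    have h1 := norm_le_of_gram_M S Q (slice 0 (v - u))
    rw [hvf, norm_zero, mul_zero] at h1
    have h2 := norm_le_of_mem S Q (Submodule.sub_mem _ hv hu)
    rw [le_antisymm h1 (norm_nonneg _), mul_zero] at h2
    exact sub_eq_zero.1 (norm_le_zero_iff.1 h2)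

/-- The error of interpolation is bounded by the mismatch of the transforms outside the torus. -/
theorem norm_sub_le_of_interpolates (S : SymbolOps φ) (Q : ProlongOps Y) {f u : L2R}
    (hf : Summable fun k => ‖slice k f‖) (hu : u ∈ quasiShiftSpace φ Y) (hfu : Interpolates Y f u) :
    ‖f - u‖ ≤
      ((1 + (ratioConst φ).toReal * Q.κ) * ((1 + Q.κ ^ 2 * (ratioConst φ).toReal) * Q.κ) + 1) *
      ∑' k : {k : ℤ // k ≠ 0}, ‖slice k f - S.T k (Q.A k (S.M (slice 0 f)))‖ := by
  set g := slice 0 f with hg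
  set D : ℤ → L2T := fun k => slice k f - S.T k (Q.A k (S.M g)) with hD
  set C := (ratioConst φ).toReal with hC
  have hC0 : 0 ≤ C := ENNReal.toReal_nonneg
  have hκ := Q.κ_nonneg
  set d := slice 0 (f - u) with hd
  have hdg : d = g - slice 0 u := map_sub _ _ _
  have hTA : ∀ h, Summable fun k => ‖S.T k (Q.A k h)‖ := fun h =>
    Summable.of_nonneg_of_le (fun _ => norm_nonneg _) (fun k => norm_T_A_le S Q k h)
      (S.summable_τ.mul_right _)
  have hDs : Summable fun k => ‖D k‖ :=
    Summable.of_nonneg_of_le (fun _ => norm_nonneg _) (fun k => norm_sub_le _ _)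
      (hf.add (hTA (S.M g)))
  have hus := summable_norm_slice S Q hu
  have hsamp := (interpolates_iff Q hf hus).1 hfu
  have hD0 : D 0 = 0 := by
    simp only [hD]
    rw [Q.zero_apply, S.T_M, sub_self]
  set E := ∑' k : {k : ℤ // k ≠ 0}, ‖D k‖ with hE
  -- the sampled mismatch is the image of the error on the torus under `P M_φ`
  have h1 : gram S Q (S.M d) = -∑' k : {k : ℤ // k ≠ 0}, (Q.A k).adjoint (D k) := by
    have h2 := tsum_eq_zero_add_tsum_ne (summable_adjoint Q hDs)
    rw [hD0, map_zero, zero_add] at h2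
    rw [← h2, hdg, map_sub, map_sub, ← sampling_eq_gram S Q hu, hsamp, sampling,
      ← (hasSum_gram S Q _).tsum_eq, ← (hasSum_gram S Q _).summable.tsum_sub
        (summable_adjoint Q hf),
      ← tsum_neg]
    exact tsum_congr fun k => by rw [← map_sub, ← map_neg, neg_sub]
  have h2 : ‖d‖ ≤ (1 + Q.κ ^ 2 * C) * (Q.κ * E) := by
    refine (norm_le_of_gram_M S Q d).trans ?_
    rw [h1, norm_neg]
    gcongr
    exact norm_tsum_ne_adjoint_le Q hDs
  have hfus : Summable fun k => ‖slice k (f - u)‖ := by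
    simp_rw [map_sub]
    exact Summable.of_nonneg_of_le (fun _ => norm_nonneg _) (fun k => norm_sub_le _ _) (hf.add hus)
  have h3 : ∀ k, slice k (f - u) = D k + S.T k (Q.A k (S.M d)) := fun k => by
    rw [map_sub, slice_eq_of_mem S Q hu, hdg]
    simp only [hD, map_sub]
    abel
  have h4 : ∑' k : {k : ℤ // k ≠ 0}, ‖slice k (f - u)‖ ≤ E + C * (Q.κ * ‖d‖) := by
    have hD' : Summable fun k : {k : ℤ // k ≠ 0} => ‖D k‖ := hDs.subtype _
    have hτ : Summable fun k : {k : ℤ // k ≠ 0} => S.τ k * (Q.κ * ‖d‖) :=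
      (S.summable_τ.subtype _).mul_right _
    rw [hE, hC, ← S.tsum_τ, ← tsum_mul_right, ← hD'.tsum_add hτ]
    refine (hfus.subtype _).tsum_le_tsum (fun k => ?_) (hD'.add hτ)
    rw [h3]
    refine (norm_add_le _ _).trans (add_le_add le_rfl ((norm_T_A_le S Q k _).trans ?_))
    gcongr
    · exact S.τ_nonneg k
    · exact norm_M_le S d
  have h5 := norm_le_tsum_slice hfus
  rw [tsum_eq_zero_add_tsum_ne hfus] at h5
  calc ‖f - u‖ ≤ ‖d‖ + (E + C * (Q.κ * ‖d‖)) := h5.trans (by gcongr)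
    _ = (1 + C * Q.κ) * ‖d‖ + E := by ring
    _ ≤ (1 + C * Q.κ) * ((1 + Q.κ ^ 2 * C) * (Q.κ * E)) + E := by gcongr
    _ = _ := by ring

end Space

end

end QuasiShift

open QuasiShift

/-! ### Convergence of the interpolants -/

theorem mainTheorem1 {A : Type*} [Preorder A] [IsDirectedOrder A] [Nonempty A]
    (X Y : ℤ → ℝ) (hX : QuasiShift.IsCIS X) (hY : QuasiShift.IsCIS Y)
    (ψ : QuasiShift.L2R) (hA1 : QuasiShift.CondA1 ψ) (hA2 : QuasiShift.CondA2 ψ)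
    (φ : A → QuasiShift.L2R)
    (hB1 : QuasiShift.CondB1 φ) (hB2 : QuasiShift.CondB2 φ)
    (hB3 : QuasiShift.CondB3 ψ X φ) (hB4 : QuasiShift.CondB4 ψ X Y φ)
    (f : QuasiShift.L2R) (hf : f ∈ QuasiShift.quasiShiftSpace ψ X) :
    (∀ α, ∃! u : QuasiShift.L2R,
        u ∈ QuasiShift.quasiShiftSpace (φ α) Y ∧ QuasiShift.Interpolates Y f u) ∧
      ∀ I : A → QuasiShift.L2R,
        (∀ α, I α ∈ QuasiShift.quasiShiftSpace (φ α) Y ∧ QuasiShift.Interpolates Y f (I α)) →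
          Tendsto (fun α => ‖f - I α‖) atTop (𝓝 0) := by
  obtain ⟨QX⟩ := hX.nonempty_prolongOps
  obtain ⟨Q⟩ := hY.nonempty_prolongOps
  obtain ⟨Sψ⟩ := nonempty_symbolOps hA1 hA2
  have hS : ∀ α, Nonempty (SymbolOps (φ α)) := fun α => nonempty_symbolOps (hB1 α).1 (hB1 α).2
  have S : ∀ α, SymbolOps (φ α) := fun α => (hS α).some
  have hfs := summable_norm_slice Sψ QX hf
  refine ⟨fun α => existsUnique_interpolates (S α) Q hfs, fun I hI => ?_⟩
  set g := slice 0 f with hg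
  set C := (⨆ α, ratioConst (φ α)).toReal with hC
  have hCα : ∀ α, (ratioConst (φ α)).toReal ≤ C := fun α =>
    ENNReal.toReal_mono hB2.ne (le_iSup (fun α => ratioConst (φ α)) α)
  have hκ := Q.κ_nonneg
  set E : A → ℝ := fun α => ∑' k : {k : ℤ // k ≠ 0},
    ‖slice k f - (S α).T k (Q.A k ((S α).M g))‖ with hE
  -- (B3) and (B4) control the two parts of the mismatch
  have hEle : ∀ α, ENNReal.ofReal (E α) ≤
      (∑' k : {k : ℤ // k ≠ 0}, ‖opT ψ k (prolong X k (opM ψ g - opM (φ α) g))‖ₑ) +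
      ∑' k : {k : ℤ // k ≠ 0},
        ‖opT (φ α) k (prolong Y k (opM (φ α) g)) - opT ψ k (prolong X k (opM (φ α) g))‖ₑ := by
    intro α
    have hsum : Summable fun k : ℤ => ‖slice k f - (S α).T k (Q.A k ((S α).M g))‖ :=
      Summable.of_nonneg_of_le (fun _ => norm_nonneg _) (fun k => norm_sub_le _ _)
        (hfs.add (Summable.of_nonneg_of_le (fun _ => norm_nonneg _)
          (fun k => norm_T_A_le (S α) Q k _) ((S α).summable_τ.mul_right _)))
    rw [hE, ENNReal.ofReal_tsum_of_nonneg (fun _ => norm_nonneg _) (hsum.subtype _),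
      ← ENNReal.tsum_add]
    refine ENNReal.tsum_le_tsum fun k => ?_
    rw [ofReal_norm, slice_eq_of_mem Sψ QX hf, Sψ.opM_eq, (S α).opM_eq, QX.prolong_eq,
      QX.prolong_eq, Q.prolong_eq, Sψ.opT_eq, Sψ.opT_eq, (S α).opT_eq]
    refine (le_of_eq ?_).trans (enorm_sub_le)
    congr 1
    simp only [map_sub]
    abel
  have hE0 : Tendsto E atTop (𝓝 0) := by
    have h1 : Tendsto (fun α => ENNReal.ofReal (E α)) atTop (𝓝 0) :=
      tendsto_of_tendsto_of_tendsto_of_le_of_le tendsto_const_nhds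
        (by simpa using (hB3 g).add (hB4 g)) (fun _ => zero_le) hEle
    have h2 := (ENNReal.tendsto_toReal ENNReal.zero_ne_top).comp h1
    refine h2.congr fun α => ?_
    exact ENNReal.toReal_ofReal (tsum_nonneg fun _ => norm_nonneg _)
  refine squeeze_zero (fun _ => norm_nonneg _) (fun α => ?_)
    (by simpa using hE0.const_mul ((1 + C * Q.κ) * ((1 + Q.κ ^ 2 * C) * Q.κ) + 1))
  refine (norm_sub_le_of_interpolates (S α) Q hfs (hI α).1 (hI α).2).trans ?_
  have h1 := hCα α
  have h2 : 0 ≤ (ratioConst (φ α)).toReal := ENNReal.toReal_nonneg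
  have h3 : 0 ≤ E α := tsum_nonneg fun _ => norm_nonneg _
  gcongr
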